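/- Let $C$ be a generalized Cartan matrix with index set $\{1,\dots,l\}$, let $\mathfrak g=\mathfrak g(C)$ be the associated Kac–Moody Lie algebra over $\mathbb C$ (the quotient of the Lie algebra generated by $\mathfrak h$, $e_i$, $f_i$ with the usual relations, for a minimal realization of $C$, by the largest ideal meeting $\mathfrak h$ trivially), with Cartan subalgebra $\mathfrak h$, simple roots $\alpha_i$, simple coroots $\alpha_i^\vee$, root spaces $\mathfrak g_\alpha$, positive roots $\Delta^+$, and $N^+=\bigoplus_{\alpha\in\Delta^+}\mathfrak g_\alpha$. Put $\mathfrak g'=[\mathfrak g,\mathfrak g]$, $\mathfrak h'=\sum_i\mathbb C\alpha_i^\vee$, and let $\mathfrak h''$ be a complement of $\mathfrak h'$ in $\mathfrak h$. Let $A$ be a finitely generated commutative associative unital $\mathbb C$-algebra, and let $\widetilde{\mathfrak g}=\mathfrak g'\otimes A\oplus\mathfrak h''$ be the Lie algebra with $[X\otimes a,Y\otimes b]=[X,Y]\otimes ab$, $[h,X\otimes a]=[h,X]\otimes a$, $[h,h']=0$ for $X,Y\in\mathfrak g'$, $a,b\in A$, $h,h'\in\mathfrak h''$. Put $\widetilde{\mathfrak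 h}=\mathfrak h'\otimes A\oplus\mathfrak h''$, and regard $\mathfrak h=\mathfrak h'\otimes 1\oplus\mathfrak h''$ as a subspace of it. For a linear map $\psi:\widetilde{\mathfrak h}\to\mathbb C$ and a family $\{K_\alpha\}_{\alpha\in\Delta^+}$ of ideals of $A$, let $M(\psi,\{K_\alpha\})$ be the $\widetilde{\mathfrak g}$-module generated by a vector $v$ subject to the relations $(N^+\otimes A)v=0$, $hv=\psi(h)v$ for $h\in\widetilde{\mathfrak h}$, and $(X_{-\alpha}\otimes a)v=0$ for all $\alpha\in\Delta^+$, $X_{-\alpha}\in\mathfrak g_{-\alpha}$, $a\in K_\alpha$; that is, the quotient of the Verma module of highest weight $\psi$ by the submodule generated by the vectors $(X_{-\alpha}\otimes a)v$ in the last family. For a dominant integral weight $\lambda\in\mathfrak h^*$ (that is, $\lambda(\alpha_i^\vee)\in\mathbb Z_{\ge 0}$ for all $i$) and $\alpha=\sum_i m_i\alpha_i\in\Delta^+$ put $N_{\lambda,\alpha}=\sum_i m_i\lambda(\alpha_i^\vee)$. If $\psi|_{\mathfrak h}=\lambda$ and $I$ is an ideal of $A$ with $\psi|_{\mathfrak h'\otimes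 I}=0$, put $M(\psi,I)=M(\psi,\{I^{N_{\lambda,\alpha}}\}_{\alpha\in\Delta^+})$, with the convention $I^0=A$. **Theorem.** Let $I$ and $J$ be coprime ideals of finite codimension in $A$, let $\lambda,\mu\in\mathfrak h^*$ be dominant integral weights, and let $\psi_1,\psi_2:\widetilde{\mathfrak h}\to\mathbb C$ be linear maps with $\psi_1|_{\mathfrak h'\otimes I}=0$, $\psi_2|_{\mathfrak h'\otimes J}=0$, $\psi_1|_{\mathfrak h}=\lambda$, $\psi_2|_{\mathfrak h}=\mu$. For $\alpha\in\Delta^+$ put $K_\alpha=I^{N_{\lambda,\alpha}}\cap J^{N_{\mu,\alpha}}$. Then, as $\widetilde{\mathfrak g}$-modules, $$M(\psi_1+\psi_2,\{K_\alpha\}_{\alpha\in\Delta^+})\;\cong\;M(\psi_1,I)\otimes_{\mathbb C}M(\psi_2,J).$$ -/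

import Mathlib

open scoped TensorProduct

noncomputable section

namespace KacMoody

universe u v w

/-! ## Kac–Moody algebras -/

/-- Generalized Cartan matrices. -/
structure IsGeneralizedCartan {ι : Type u} (C : Matrix ι ι ℤ) : Prop where
  diag : ∀ i, C i i = 2
  off_diag_nonpos : ∀ i j, i ≠ j → C i j ≤ 0
  zero_symm : ∀ i j, C i j = 0 → C j i = 0

/-- A (minimal) realization `(𝔥, {α_i}, {α_i^∨})` of a square integer matrix over `ℂ`:
simple roots and simple coroots are linearly independent, `⟨α_i^∨, α_j⟩ = C i j`, and
`n - rank C = dim 𝔥 - n`, where `n` is the size of `C`. -/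
structure Realization {ι : Type u} [Fintype ι] (C : Matrix ι ι ℤ)
    (𝔥 : Type v) [AddCommGroup 𝔥] [Module ℂ 𝔥] where
  root : ι → Module.Dual ℂ 𝔥
  coroot : ι → 𝔥
  root_indep : LinearIndependent ℂ root
  coroot_indep : LinearIndependent ℂ coroot
  pairing : ∀ i j, root j (coroot i) = (C i j : ℂ)
  finrank_add_rank :
    Module.finrank ℂ 𝔥 + (C.map (Int.cast : ℤ → ℂ)).rank = 2 * Fintype.card ι

/-- Generators: the elements of `𝔥` and the Chevalley generators `e_i`, `f_i`. -/
inductive Gen (ι : Type u) (𝔥 : Type v) : Type (max u v)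
  | H : 𝔥 → Gen ι 𝔥
  | E : ι → Gen ι 𝔥
  | F : ι → Gen ι 𝔥

/-- The generators `x ∈ 𝔥` as elements of the free Lie algebra. -/
abbrev genH (ι : Type u) {𝔥 : Type v} (x : 𝔥) : FreeLieAlgebra ℂ (Gen ι 𝔥) :=
  FreeLieAlgebra.of ℂ (Gen.H x)

/-- The generators `e_i` as elements of the free Lie algebra. -/
abbrev genE {ι : Type u} (𝔥 : Type v) (i : ι) : FreeLieAlgebra ℂ (Gen ι 𝔥) :=
  FreeLieAlgebra.of ℂ (Gen.E i)

/-- The generators `f_i` as elements of the free Lie algebra. -/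
abbrev genF {ι : Type u} (𝔥 : Type v) (i : ι) : FreeLieAlgebra ℂ (Gen ι 𝔥) :=
  FreeLieAlgebra.of ℂ (Gen.F i)

section Construction

variable {ι : Type u} [Fintype ι] {C : Matrix ι ι ℤ}
  {𝔥 : Type v} [AddCommGroup 𝔥] [Module ℂ 𝔥] (R : Realization C 𝔥)

/-- The defining relations of the auxiliary algebra, each as an element of the free Lie algebra
that is to be killed. The first two families make the map from `𝔥` linear. -/
inductive Rel : FreeLieAlgebra ℂ (Gen ι 𝔥) → Prop
  | add (x y : 𝔥) : Rel (genH ι (x + y) - genH ι x - genH ι y)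
  | smul (c : ℂ) (x : 𝔥) : Rel (genH ι (c • x) - c • genH ι x)
  | hh (x y : 𝔥) : Rel ⁅genH ι x, genH ι y⁆
  | ef_same (i : ι) : Rel (⁅genE 𝔥 i, genF 𝔥 i⁆ - genH ι (R.coroot i))
  | ef_ne (i j : ι) (hij : i ≠ j) : Rel ⁅genE 𝔥 i, genF 𝔥 j⁆
  | he (x : 𝔥) (i : ι) : Rel (⁅genH ι x, genE 𝔥 i⁆ - R.root i x • genE 𝔥 i)
  | hf (x : 𝔥) (i : ι) : Rel (⁅genH ι x, genF 𝔥 i⁆ + R.root i x • genF 𝔥 i)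

/-- The ideal of the free Lie algebra generated by the relations. -/
abbrev relIdeal : LieIdeal ℂ (FreeLieAlgebra ℂ (Gen ι 𝔥)) :=
  LieSubmodule.lieSpan ℂ (FreeLieAlgebra ℂ (Gen ι 𝔥)) {x | Rel R x}

/-- The auxiliary Lie algebra `𝔤̃(C)`, before dividing by the maximal ideal that meets `𝔥`
trivially. -/
def Aux : Type (max u v) := FreeLieAlgebra ℂ (Gen ι 𝔥) ⧸ relIdeal R

instance : LieRing (Aux R) :=
  inferInstanceAs (LieRing (FreeLieAlgebra ℂ (Gen ι 𝔥) ⧸ relIdeal R))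

instance : LieAlgebra ℂ (Aux R) :=
  inferInstanceAs (LieAlgebra ℂ (FreeLieAlgebra ℂ (Gen ι 𝔥) ⧸ relIdeal R))

/-- The quotient map from the free Lie algebra. -/
def Aux.mk : FreeLieAlgebra ℂ (Gen ι 𝔥) →ₗ⁅ℂ⁆ Aux R where
  toFun x := (LieSubmodule.Quotient.mk x : FreeLieAlgebra ℂ (Gen ι 𝔥) ⧸ relIdeal R)
  map_add' _ _ := rfl
  map_smul' _ _ := rfl
  map_lie' := rfl

lemma Aux.mk_eq_zero_of_rel {x : FreeLieAlgebra ℂ (Gen ι 𝔥)} (hx : Rel R x) :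
    Aux.mk R x = 0 :=
  (LieSubmodule.Quotient.mk_eq_zero' (N := relIdeal R)).2
    (LieSubmodule.subset_lieSpan hx)

/-- The map `𝔥 → 𝔤̃(C)`. -/
def Aux.cartan : 𝔥 →ₗ[ℂ] Aux R where
  toFun x := Aux.mk R (genH ι x)
  map_add' x y := by
    have h := Aux.mk_eq_zero_of_rel R (Rel.add x y)
    rw [map_sub, map_sub, sub_sub, sub_eq_zero] at h
    exact h
  map_smul' c x := by
    have h := Aux.mk_eq_zero_of_rel R (Rel.smul c x)
    rw [map_sub, map_smul, sub_eq_zero] at h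
    exact h

/-- The largest ideal of `𝔤̃(C)` meeting `𝔥` trivially (the sum of all such ideals). -/
def rad : LieIdeal ℂ (Aux R) :=
  sSup {N | (N : Submodule ℂ (Aux R)) ⊓ LinearMap.range (Aux.cartan R) = ⊥}

/-- The Kac–Moody algebra `𝔤 = 𝔤(C)`. -/
def KMAlgebra : Type (max u v) := Aux R ⧸ rad R

instance : LieRing (KMAlgebra R) := inferInstanceAs (LieRing (Aux R ⧸ rad R))

instance : LieAlgebra ℂ (KMAlgebra R) := inferInstanceAs (LieAlgebra ℂ (Aux R ⧸ rad R))

/-- The quotient map `𝔤̃(C) → 𝔤(C)`. -/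
def KMAlgebra.mk : Aux R →ₗ⁅ℂ⁆ KMAlgebra R where
  toFun x := (LieSubmodule.Quotient.mk x : Aux R ⧸ rad R)
  map_add' _ _ := rfl
  map_smul' _ _ := rfl
  map_lie' := rfl

/-- The embedding of the Cartan subalgebra `𝔥 → 𝔤`. -/
def H : 𝔥 →ₗ[ℂ] KMAlgebra R := (KMAlgebra.mk R : Aux R →ₗ[ℂ] KMAlgebra R) ∘ₗ Aux.cartan R

/-- The Chevalley generators `e_i`. -/
def E (i : ι) : KMAlgebra R := KMAlgebra.mk R (Aux.mk R (genE 𝔥 i))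

/-- The Chevalley generators `f_i`. -/
def F (i : ι) : KMAlgebra R := KMAlgebra.mk R (Aux.mk R (genF 𝔥 i))

lemma lie_E_F (i : ι) : ⁅E R i, F R i⁆ = H R (R.coroot i) := by
  have h := Aux.mk_eq_zero_of_rel R (Rel.ef_same (R := R) i)
  rw [map_sub, LieHom.map_lie, sub_eq_zero] at h
  simp only [E, F, ← LieHom.map_lie, h]
  rfl

/-- The derived algebra `𝔤' = [𝔤, 𝔤]`. -/
abbrev derived : LieIdeal ℂ (KMAlgebra R) :=
  ⁅(⊤ : LieIdeal ℂ (KMAlgebra R)), (⊤ : LieIdeal ℂ (KMAlgebra R))⁆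

/-- `𝔥'`, the span of the simple coroots inside `𝔤`. -/
abbrev derivedCartan : Submodule ℂ (KMAlgebra R) :=
  Submodule.span ℂ (Set.range fun i => H R (R.coroot i))

lemma derivedCartan_le : derivedCartan R ≤ (derived R : Submodule ℂ (KMAlgebra R)) := by
  refine Submodule.span_le.2 ?_
  rintro _ ⟨i, rfl⟩
  have : ⁅E R i, F R i⁆ ∈ derived R :=
    LieSubmodule.lie_mem_lie (LieSubmodule.mem_top _) (LieSubmodule.mem_top _)
  rw [lie_E_F] at this
  exact this

/-- `𝔥''` is a complement of `𝔥'` in `𝔥`. (Every subspace of `𝔥` is a Lie subalgebra of `𝔤`.) -/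
structure IsCartanComplement (𝔥₂ : LieSubalgebra ℂ (KMAlgebra R)) : Prop where
  disjoint : Disjoint (derivedCartan R) 𝔥₂.toSubmodule
  sup_eq : derivedCartan R ⊔ 𝔥₂.toSubmodule = LinearMap.range (H R)

/-! ### Roots and weights -/

/-- The weight space `𝔤_γ`, `γ ∈ 𝔥^*`. -/
def rootSpace (γ : Module.Dual ℂ 𝔥) : Submodule ℂ (KMAlgebra R) where
  carrier := {x | ∀ t : 𝔥, ⁅H R t, x⁆ = γ t • x}
  add_mem' {x y} hx hy t := by rw [lie_add, hx t, hy t, smul_add]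
  zero_mem' t := by simp
  smul_mem' c x hx t := by rw [lie_smul, hx t, smul_comm]

/-- The element `∑ m_i α_i` of `𝔥^*`. -/
def rootOf (m : ι → ℕ) : Module.Dual ℂ 𝔥 := ∑ i, m i • R.root i

/-- The positive roots `Δ⁺`, a root `α = ∑ m_i α_i` being given by its coefficients `m_i`. -/
def positiveRoots : Set (ι → ℕ) := {m | m ≠ 0 ∧ rootSpace R (rootOf R m) ≠ ⊥}

/-- `N⁺`, the sum of the positive root spaces. -/
def nPlus : Submodule ℂ (KMAlgebra R) := ⨆ α ∈ positiveRoots R, rootSpace R (rootOf R α)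

/-- Dominant integral weights: `λ(α_i^∨) ∈ ℤ_{≥ 0}` for all `i`. -/
def IsDominantIntegral (l : Module.Dual ℂ 𝔥) : Prop := ∀ i, ∃ n : ℕ, l (R.coroot i) = n

/-- `λ(α_i^∨)` as a natural number, for `λ` dominant integral. -/
def label (l : Module.Dual ℂ 𝔥) (i : ι) : ℕ := ⌊(l (R.coroot i)).re⌋₊

lemma label_spec {l : Module.Dual ℂ 𝔥} (hl : IsDominantIntegral R l) (i : ι) :
    (label R l i : ℂ) = l (R.coroot i) := by
  obtain ⟨n, hn⟩ := hl i
  simp [label, hn]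

/-- `N_{λ,α} = ∑ m_i λ(α_i^∨)` for `α = ∑ m_i α_i`. -/
def rootLevel (l : Module.Dual ℂ 𝔥) (α : ι → ℕ) : ℕ := ∑ i, α i * label R l i

/-! ## The Lie algebra `𝔤' ⊗ A ⊕ 𝔥''` -/

section Loop

variable (A : Type w) [CommRing A] [Algebra ℂ A] (𝔥₂ : LieSubalgebra ℂ (KMAlgebra R))

/-- The derivation `X ⊗ a ↦ [x, X] ⊗ a` of `𝔤' ⊗ A`, for `x ∈ 𝔤`. -/
def adDerivation (x : KMAlgebra R) :
    LieDerivation ℂ (A ⊗[ℂ] derived R) (A ⊗[ℂ] derived R) where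
  toLinearMap := (LieModule.toEnd ℂ (KMAlgebra R) (derived R) x).lTensor A
  leibniz' s t := by
    induction s using TensorProduct.induction_on with
    | zero => simp
    | add s₁ s₂ h₁ h₂ => simp only [add_lie, lie_add, map_add, h₁, h₂]; abel
    | tmul a X =>
      induction t using TensorProduct.induction_on with
      | zero => simp
      | add t₁ t₂ h₁ h₂ => simp only [add_lie, lie_add, map_add, h₁, h₂]; abel
      | tmul b Y =>
        have key : ⁅x, ⁅X, Y⁆⁆ = ⁅X, ⁅x, Y⁆⁆ - ⁅Y, ⁅x, X⁆⁆ := by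
          apply Subtype.ext
          change ⁅x, ⁅(X : KMAlgebra R), (Y : KMAlgebra R)⁆⁆ =
            ⁅(X : KMAlgebra R), ⁅x, (Y : KMAlgebra R)⁆⁆ -
              ⁅(Y : KMAlgebra R), ⁅x, (X : KMAlgebra R)⁆⁆
          rw [leibniz_lie, ← lie_skew (Y : KMAlgebra R) ⁅x, (X : KMAlgebra R)⁆]
          abel
        simp only [LieAlgebra.ExtendScalars.bracket_tmul, LinearMap.lTensor_tmul,
          LieModule.toEnd_apply_apply, key, TensorProduct.tmul_sub, mul_comm b a]

/-- The action of `𝔥''` on `𝔤' ⊗ A`. -/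
def loopAction : 𝔥₂ →ₗ⁅ℂ⁆ LieDerivation ℂ (A ⊗[ℂ] derived R) (A ⊗[ℂ] derived R) where
  toFun x := adDerivation R A x
  map_add' x y := by
    apply LieDerivation.ext
    intro t
    change (LieModule.toEnd ℂ (KMAlgebra R) (derived R) ((x : KMAlgebra R) + y)).lTensor A t =
      (LieModule.toEnd ℂ (KMAlgebra R) (derived R) x).lTensor A t +
        (LieModule.toEnd ℂ (KMAlgebra R) (derived R) y).lTensor A t
    rw [map_add, LinearMap.lTensor_add]; rfl
  map_smul' c x := by
    apply LieDerivation.ext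
    intro t
    change (LieModule.toEnd ℂ (KMAlgebra R) (derived R) (c • (x : KMAlgebra R))).lTensor A t =
      c • (LieModule.toEnd ℂ (KMAlgebra R) (derived R) x).lTensor A t
    rw [map_smul, LinearMap.lTensor_smul]; rfl
  map_lie' {x y} := by
    apply LieDerivation.ext
    intro t
    rw [LieDerivation.lie_apply]
    have key : LieModule.toEnd ℂ (KMAlgebra R) (derived R)
          ⁅(x : KMAlgebra R), (y : KMAlgebra R)⁆ =
        LieModule.toEnd ℂ (KMAlgebra R) (derived R) x ∘ₗ
            LieModule.toEnd ℂ (KMAlgebra R) (derived R) y -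
          LieModule.toEnd ℂ (KMAlgebra R) (derived R) y ∘ₗ
            LieModule.toEnd ℂ (KMAlgebra R) (derived R) x :=
      LinearMap.ext fun m => lie_lie (x : KMAlgebra R) (y : KMAlgebra R) m
    change (LieModule.toEnd ℂ (KMAlgebra R) (derived R)
        ⁅(x : KMAlgebra R), (y : KMAlgebra R)⁆).lTensor A t =
      (LieModule.toEnd ℂ (KMAlgebra R) (derived R) x).lTensor A
        ((LieModule.toEnd ℂ (KMAlgebra R) (derived R) y).lTensor A t) -
      (LieModule.toEnd ℂ (KMAlgebra R) (derived R) y).lTensor A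
        ((LieModule.toEnd ℂ (KMAlgebra R) (derived R) x).lTensor A t)
    rw [← LinearMap.comp_apply, ← LinearMap.comp_apply, ← LinearMap.lTensor_comp,
      ← LinearMap.lTensor_comp, ← LinearMap.sub_apply, ← LinearMap.lTensor_sub, key]

/-- The Lie algebra `𝔤̃ = 𝔤' ⊗ A ⊕ 𝔥''`, with
`[X ⊗ a, Y ⊗ b] = [X, Y] ⊗ ab` and `[h, X ⊗ a] = [h, X] ⊗ a`. -/
abbrev LoopAlgebra : Type (max u v w) :=
  LieAlgebra.SemiDirectSum (A ⊗[ℂ] derived R) 𝔥₂ (loopAction R A 𝔥₂)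

/-- `𝔥̃ = 𝔥' ⊗ A ⊕ 𝔥''`. -/
abbrev LoopCartan : Type (max u v w) := (A ⊗[ℂ] derivedCartan R) × 𝔥₂

/-- The inclusion `𝔥̃ → 𝔤̃`. -/
def loopCartanMap : LoopCartan R A 𝔥₂ →ₗ[ℂ] LoopAlgebra R A 𝔥₂ :=
  ((LieAlgebra.SemiDirectSum.toProdl (loopAction R A 𝔥₂)).symm :
      ((A ⊗[ℂ] derived R) × 𝔥₂) →ₗ[ℂ] LoopAlgebra R A 𝔥₂) ∘ₗ
    LinearMap.prodMap ((Submodule.inclusion (derivedCartan_le R)).lTensor A) LinearMap.id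

/-- The element `X ⊗ a` of `𝔤̃`, for `X ∈ 𝔤'`. -/
def loopElt (X : derived R) (a : A) : LoopAlgebra R A 𝔥₂ :=
  LieAlgebra.SemiDirectSum.inl (loopAction R A 𝔥₂) (a ⊗ₜ[ℂ] X)

variable {A 𝔥₂}

/-- `ψ` vanishes on `𝔥' ⊗ I`. -/
def VanishesOn (ψ : Module.Dual ℂ (LoopCartan R A 𝔥₂)) (I : Ideal A) : Prop :=
  ∀ a ∈ I, ∀ x : derivedCartan R, ψ (a ⊗ₜ[ℂ] x, 0) = 0

/-- `ψ` restricts to `λ` on `𝔥 = 𝔥' ⊗ 1 ⊕ 𝔥''`. -/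
def RestrictsTo (ψ : Module.Dual ℂ (LoopCartan R A 𝔥₂)) (l : Module.Dual ℂ 𝔥) : Prop :=
  ∀ (t : 𝔥) (x : derivedCartan R) (y : 𝔥₂), H R t = (x : KMAlgebra R) + (y : KMAlgebra R) →
    ψ ((1 : A) ⊗ₜ[ℂ] x, y) = l t

end Loop

end Construction

/-! ## Cyclic modules over a Lie algebra -/

section Cyclic

variable {L : Type w} [LieRing L] [LieAlgebra ℂ L]

attribute [local instance 100] LieRing.ofAssociativeRing

/-- The `L`-module `U(L) / U(L)S`: it has one generator `v`, the class of `1`, and the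
relations `s v = 0` for `s ∈ S`. -/
def CyclicModule (S : Set (UniversalEnvelopingAlgebra ℂ L)) : Type w :=
  UniversalEnvelopingAlgebra ℂ L ⧸ Submodule.span (UniversalEnvelopingAlgebra ℂ L) S

variable (S : Set (UniversalEnvelopingAlgebra ℂ L))

instance : AddCommGroup (CyclicModule S) :=
  inferInstanceAs (AddCommGroup
    (UniversalEnvelopingAlgebra ℂ L ⧸ Submodule.span (UniversalEnvelopingAlgebra ℂ L) S))

instance : Module (UniversalEnvelopingAlgebra ℂ L) (CyclicModule S) :=
  inferInstanceAs (Module (UniversalEnvelopingAlgebra ℂ L)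
    (UniversalEnvelopingAlgebra ℂ L ⧸ Submodule.span (UniversalEnvelopingAlgebra ℂ L) S))

instance : Module ℂ (CyclicModule S) :=
  inferInstanceAs (Module ℂ
    (UniversalEnvelopingAlgebra ℂ L ⧸ Submodule.span (UniversalEnvelopingAlgebra ℂ L) S))

instance : IsScalarTower ℂ (UniversalEnvelopingAlgebra ℂ L) (CyclicModule S) :=
  inferInstanceAs (IsScalarTower ℂ (UniversalEnvelopingAlgebra ℂ L)
    (UniversalEnvelopingAlgebra ℂ L ⧸ Submodule.span (UniversalEnvelopingAlgebra ℂ L) S))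

instance : LieRingModule L (CyclicModule S) where
  bracket x m := UniversalEnvelopingAlgebra.ι ℂ x • m
  add_lie x y m := by
    rw [map_add, add_smul]
  lie_add x m n := smul_add _ m n
  leibniz_lie x y m := by
    change UniversalEnvelopingAlgebra.ι ℂ x • UniversalEnvelopingAlgebra.ι ℂ y • m =
      UniversalEnvelopingAlgebra.ι ℂ ⁅x, y⁆ • m +
        UniversalEnvelopingAlgebra.ι ℂ y • UniversalEnvelopingAlgebra.ι ℂ x • m
    rw [LieHom.map_lie, LieRing.of_associative_ring_bracket, sub_smul, mul_smul, mul_smul,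
      sub_add_cancel]

instance : LieModule ℂ L (CyclicModule S) where
  smul_lie c x m := by
    change UniversalEnvelopingAlgebra.ι ℂ (c • x) • m = c • UniversalEnvelopingAlgebra.ι ℂ x • m
    rw [map_smul, smul_assoc]
  lie_smul c x m := by
    change UniversalEnvelopingAlgebra.ι ℂ x • c • m = c • UniversalEnvelopingAlgebra.ι ℂ x • m
    rw [← algebraMap_smul (UniversalEnvelopingAlgebra ℂ L) c m,
      ← algebraMap_smul (UniversalEnvelopingAlgebra ℂ L) c
        (UniversalEnvelopingAlgebra.ι ℂ x • m), smul_smul, smul_smul, Algebra.commutes]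

end Cyclic

/-! ## The highest weight modules -/

section Modules

variable {ι : Type u} [Fintype ι] {C : Matrix ι ι ℤ}
  {𝔥 : Type v} [AddCommGroup 𝔥] [Module ℂ 𝔥] (R : Realization C 𝔥)
  {A : Type w} [CommRing A] [Algebra ℂ A] {𝔥₂ : LieSubalgebra ℂ (KMAlgebra R)}

/-- The relations on the highest weight vector `v` of `M(ψ, {K_α})`, as elements of `U(𝔤̃)`
annihilating `v`: the relations `(N⁺ ⊗ A) v = 0` and `t v = ψ(t) v` for `t ∈ 𝔥̃` define the Verma
module `M(ψ)`; the relations `(𝔤_{-β} ⊗ K_β) v = 0`, for `β ∈ Δ⁺`, are added to them. -/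
inductive HWRel (ψ : Module.Dual ℂ (LoopCartan R A 𝔥₂)) (K : positiveRoots R → Ideal A) :
    UniversalEnvelopingAlgebra ℂ (LoopAlgebra R A 𝔥₂) → Prop
  | nPlus (X : derived R) (hX : (X : KMAlgebra R) ∈ nPlus R) (a : A) :
      HWRel ψ K (UniversalEnvelopingAlgebra.ι ℂ (loopElt R A 𝔥₂ X a))
  | weight (t : LoopCartan R A 𝔥₂) :
      HWRel ψ K (UniversalEnvelopingAlgebra.ι ℂ (loopCartanMap R A 𝔥₂ t)
        - algebraMap ℂ (UniversalEnvelopingAlgebra ℂ (LoopAlgebra R A 𝔥₂)) (ψ t))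
  | root (β : positiveRoots R) (X : derived R)
      (hX : (X : KMAlgebra R) ∈ rootSpace R (-rootOf R β)) (a : A) (ha : a ∈ K β) :
      HWRel ψ K (UniversalEnvelopingAlgebra.ι ℂ (loopElt R A 𝔥₂ X a))

/-- The highest weight `𝔤̃`-module `M(ψ, {K_α, α ∈ Δ⁺})`: the quotient of the Verma module
`M(ψ)` by the submodule generated by the `X_{-β} K_β v`, `β ∈ Δ⁺`, where `X_{-β}` runs over the
whole root space `𝔤_{-β}`. -/
abbrev HWModule (ψ : Module.Dual ℂ (LoopCartan R A 𝔥₂)) (K : positiveRoots R → Ideal A) :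
    Type (max u v w) :=
  CyclicModule {z : UniversalEnvelopingAlgebra ℂ (LoopAlgebra R A 𝔥₂) | HWRel R ψ K z}

/-- `M(ψ, I) = M(ψ, {I^{N_{λ,α}}, α ∈ Δ⁺})`, to be used with `λ` the restriction of `ψ` to `𝔥`. -/
abbrev HWModuleOfIdeal (ψ : Module.Dual ℂ (LoopCartan R A 𝔥₂)) (l : Module.Dual ℂ 𝔥)
    (I : Ideal A) : Type (max u v w) :=
  HWModule R ψ fun α => I ^ rootLevel R l α

end Modules

end KacMoody

end

/-!
The vector `v₁ ⊗ v₂` satisfies the relations of `M = M(ψ₁ + ψ₂, {K_α})`, which gives a homomorphism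
`φ : M → M(ψ₁, I) ⊗ M(ψ₂, J)`. The point is that, locally, `𝔤' ⊗ A` acts on `M` as the direct sum of
two commuting copies of itself, one for each ideal, so that `M` can be taken apart again. No basis
of an enveloping algebra is needed.

*Smoothness.* Let `Q` be an ideal of which a power is contained in each `K_α`. For each `X ∈ 𝔤'` and
each vector `m`, the elements `X ⊗ c` with `c ∈ Q ^ n` annihilate `m` for large `n`. For the highest
weight vector this holds since the `X` with this property form a Lie subalgebra that contains the
`e_i` and `f_i` (`HWModule.isSmooth`); the vectors with this property, for all `X` at once, form a
submodule (`IsSmooth.of_gen`). So `M`, with `Q = I ⊓ J`, is a module for the completion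
`lim A / Q ^ n`, in which coprimality gives an idempotent `e`, the limit of elements
`e n ∈ J ^ n` with `1 - e n ∈ I ^ n`. The operators `(e X ⊗ a)` and `((1 - e) X ⊗ a)` on `M`
(`IsSmooth.adicEnd`) form two representations of `𝔤' ⊗ A` that commute and have sum the given one.

*Injectivity of `φ`* (`injective_of_hwv_tmul`). Let `X ⊗ a` act on `M` through `1 - e`, and `y ∈ 𝔥''`
by `y - ψ₁(y)`. In this module `v` satisfies the relations of `M(ψ₂, J)`, so there is a map
`T : M(ψ₂, J) → M` with `v₂ ↦ v` (`exists_factorMap`). Next let `X ⊗ a` act on `Hom(M(ψ₂, J), M)`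
through `e` on `M`, and `y ∈ 𝔥''` by commutators. The vector `T` of this module satisfies the
relations of `M(ψ₁, I)` (`adicEnd_factorMap`), which gives a map
`Θ : M(ψ₁, I) → Hom(M(ψ₂, J), M)` with `v₁ ↦ T`. The corresponding map on the tensor product is a
homomorphism (`exists_tensorMap`) and takes `v₁ ⊗ v₂` to `v`, so it is a left inverse of `φ`.

*Surjectivity of `φ`* (`eq_top_of_hwv_tmul_mem`). The modules `M(ψ₁, I)` and `M(ψ₂, J)` are smooth for
`I` and for `J`, so for large `n` the element `X ⊗ (e n * a)` acts on `m₁ ⊗ m₂` as `X ⊗ a` acts on the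
first factor alone. Hence a submodule that contains `v₁ ⊗ v₂` is everything.

The argument works for all families of exponents, not only for the `N_{λ,α}`. It also needs no
separate treatment of the case in which some of the modules vanish.
-/

noncomputable section

namespace KacMoody

open Filter LieAlgebra

attribute [local instance 100] LieRing.ofAssociativeRing

/-! ### Cyclic modules -/

section Cyclic

variable {L : Type*} [LieRing L] [LieAlgebra ℂ L] (S : Set (UniversalEnvelopingAlgebra ℂ L))

namespace CyclicModule

/-- The generator of `U(L) / U(L)S`, the class of `1`. -/
def gen : CyclicModule S :=
  Submodule.Quotient.mk (1 : UniversalEnvelopingAlgebra ℂ L)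

variable {S}

lemma smul_gen_eq_zero {s : UniversalEnvelopingAlgebra ℂ L} (hs : s ∈ S) : s • gen S = 0 := by
  change Submodule.Quotient.mk (s • (1 : UniversalEnvelopingAlgebra ℂ L)) = _
  rw [smul_eq_mul, mul_one]
  exact (Submodule.Quotient.mk_eq_zero _).2 (Submodule.subset_span hs)

lemma lie_gen_eq_zero {x : L} (hx : UniversalEnvelopingAlgebra.ι ℂ x ∈ S) : ⁅x, gen S⁆ = 0 :=
  smul_gen_eq_zero hx

lemma lie_gen_eq_smul {x : L} {c : ℂ}
    (hx : UniversalEnvelopingAlgebra.ι ℂ x - algebraMap ℂ _ c ∈ S) :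
    ⁅x, gen S⁆ = c • gen S := by
  have h := smul_gen_eq_zero hx
  rwa [sub_smul, algebraMap_smul, sub_eq_zero] at h

/-- Elements of the enveloping algebra preserve every subspace that the Lie algebra preserves. -/
lemma _root_.UniversalEnvelopingAlgebra.smul_mem_of_lie_stable
    {N : Submodule ℂ (CyclicModule S)} (hN : ∀ (x : L), ∀ m ∈ N, ⁅x, m⁆ ∈ N)
    (u : UniversalEnvelopingAlgebra ℂ L) : ∀ m ∈ N, u • m ∈ N := by
  -- the algebra of elements that preserve `N`
  let T : Subalgebra ℂ (UniversalEnvelopingAlgebra ℂ L) :=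
    { carrier := {u | ∀ m ∈ N, u • m ∈ N}
      mul_mem' := fun {a b} ha hb m hm => by
        rw [mul_smul]; exact ha _ (hb _ hm)
      add_mem' := fun {a b} ha hb m hm => by
        rw [add_smul]; exact N.add_mem (ha _ hm) (hb _ hm)
      algebraMap_mem' := fun c m hm => by
        rw [algebraMap_smul]; exact N.smul_mem c hm }
  let f : L →ₗ⁅ℂ⁆ T :=
    { toFun := fun x => ⟨UniversalEnvelopingAlgebra.ι ℂ x, fun m hm => hN x m hm⟩
      map_add' := fun x y => Subtype.ext (map_add _ x y)
      map_smul' := fun c x => Subtype.ext (map_smul _ c x)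
      map_lie' := fun {x y} => Subtype.ext (LieHom.map_lie _ x y) }
  have h : T.val.comp (UniversalEnvelopingAlgebra.lift ℂ f) = AlgHom.id ℂ _ := by
    ext x
    simp [f]
  intro m hm
  have hu := (UniversalEnvelopingAlgebra.lift ℂ f u).2 m hm
  have h' : ((UniversalEnvelopingAlgebra.lift ℂ f u : T) : UniversalEnvelopingAlgebra ℂ L) = u :=
    DFunLike.congr_fun h u
  rwa [h'] at hu

/-- A subspace that contains the generator and is stable under the Lie algebra is everything. -/
lemma eq_top_of_lie_stable {N : Submodule ℂ (CyclicModule S)} (hgen : gen S ∈ N)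
    (hN : ∀ (x : L), ∀ m ∈ N, ⁅x, m⁆ ∈ N) : N = ⊤ := by
  refine eq_top_iff.2 fun m _ => ?_
  obtain ⟨u, rfl⟩ := Submodule.Quotient.mk_surjective _ m
  have h := UniversalEnvelopingAlgebra.smul_mem_of_lie_stable hN u _ hgen
  have : u • gen S = Submodule.Quotient.mk u := by
    change Submodule.Quotient.mk (u • (1 : UniversalEnvelopingAlgebra ℂ L)) = _
    rw [smul_eq_mul, mul_one]
  rwa [this] at h

/-- The universal property of `U(L) / U(L)S`: a vector that is annihilated by `S` in a
representation of `L` is the image of the generator under an intertwining map. -/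
lemma exists_lift {V : Type*} [AddCommGroup V] [Module ℂ V] (ρ : L →ₗ⁅ℂ⁆ Module.End ℂ V) (v : V)
    (hv : ∀ s ∈ S, UniversalEnvelopingAlgebra.lift ℂ ρ s v = 0) :
    ∃ f : CyclicModule S →ₗ[ℂ] V, f (gen S) = v ∧ ∀ (x : L) m, f ⁅x, m⁆ = ρ x (f m) := by
  let U := UniversalEnvelopingAlgebra ℂ L
  let Φ : U →ₗ[ℂ] V := (LinearMap.applyₗ v) ∘ₗ (UniversalEnvelopingAlgebra.lift ℂ ρ).toLinearMap
  have hΦ : ∀ u : U, Φ u = UniversalEnvelopingAlgebra.lift ℂ ρ u v := fun u => rfl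
  have hker : (Submodule.span U S).restrictScalars ℂ ≤ LinearMap.ker Φ := by
    intro u hu
    rw [LinearMap.mem_ker]
    refine Submodule.span_induction (p := fun u _ => Φ u = 0) (fun s hs => hv s hs) (map_zero _)
      (fun a b _ _ ha hb => by rw [map_add, ha, hb, add_zero]) (fun a b _ hb => ?_) hu
    rw [hΦ] at hb ⊢
    rw [smul_eq_mul, map_mul, Module.End.mul_apply, hb, map_zero]
  refine ⟨((Submodule.span U S).restrictScalars ℂ).liftQ Φ hker, ?_, ?_⟩
  · change Φ 1 = v
    rw [hΦ, map_one, Module.End.one_apply]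
  · intro x m
    obtain ⟨u, rfl⟩ := Submodule.Quotient.mk_surjective _ m
    change Φ (UniversalEnvelopingAlgebra.ι ℂ x * u) = ρ x (Φ u)
    rw [hΦ, hΦ, map_mul, UniversalEnvelopingAlgebra.lift_ι_apply, Module.End.mul_apply]

end CyclicModule

end Cyclic

/-! ### Representations of a semidirect sum -/

section SemiDirect

variable {B D : Type*} [LieRing B] [LieAlgebra ℂ B] [LieRing D] [LieAlgebra ℂ D]
  {δ : D →ₗ⁅ℂ⁆ LieDerivation ℂ B B}

lemma SemiDirect.inl_add_inr (x : B ⋊⁅δ⁆ D) :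
    SemiDirectSum.inl δ x.left + SemiDirectSum.inr δ x.right = x := by
  ext <;> simp

lemma SemiDirect.lie_inr_inl (d : D) (b : B) :
    ⁅SemiDirectSum.inr δ d, SemiDirectSum.inl δ b⁆ = SemiDirectSum.inl δ (δ d b) := by
  ext <;> simp

/-- A representation of `B ⋊ D` from representations of `B` and of `D` that are compatible with
the action of `D` on `B`. -/
def SemiDirect.lift {V : Type*} [AddCommGroup V] [Module ℂ V] (f : B →ₗ⁅ℂ⁆ Module.End ℂ V)
    (g : D →ₗ⁅ℂ⁆ Module.End ℂ V) (h : ∀ d b, f (δ d b) = ⁅g d, f b⁆) :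
    (B ⋊⁅δ⁆ D) →ₗ⁅ℂ⁆ Module.End ℂ V where
  toFun x := f x.left + g x.right
  map_add' x y := by
    rw [SemiDirectSum.add_eq_mk, map_add, map_add]; abel
  map_smul' c x := by
    rw [SemiDirectSum.smul_eq_mk, map_smul, map_smul, RingHom.id_apply, smul_add]
  map_lie' {x y} := by
    rw [SemiDirectSum.lie_eq_mk, map_sub, map_add, h, h, LieHom.map_lie, LieHom.map_lie, add_lie,
      lie_add, lie_add, ← lie_skew (f x.left) (g y.right)]
    abel

@[simp] lemma SemiDirect.lift_inl {V : Type*} [AddCommGroup V] [Module ℂ V]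
    (f : B →ₗ⁅ℂ⁆ Module.End ℂ V) (g : D →ₗ⁅ℂ⁆ Module.End ℂ V)
    (h : ∀ d b, f (δ d b) = ⁅g d, f b⁆) (b : B) :
    SemiDirect.lift f g h (SemiDirectSum.inl δ b) = f b := by
  change f b + g 0 = f b
  rw [map_zero, add_zero]

@[simp] lemma SemiDirect.lift_inr {V : Type*} [AddCommGroup V] [Module ℂ V]
    (f : B →ₗ⁅ℂ⁆ Module.End ℂ V) (g : D →ₗ⁅ℂ⁆ Module.End ℂ V)
    (h : ∀ d b, f (δ d b) = ⁅g d, f b⁆) (d : D) :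
    SemiDirect.lift f g h (SemiDirectSum.inr δ d) = g d := by
  change f 0 + g d = g d
  rw [map_zero, zero_add]

end SemiDirect

/-! ### Smooth modules and the action of the completion -/

section Smooth

variable {A : Type*} [CommRing A] {B D : Type*} [LieRing B] [LieAlgebra ℂ B] [LieAlgebra A B]
  [LieRing D] [LieAlgebra ℂ D] (δ : D →ₗ⁅ℂ⁆ LieDerivation ℂ B B)
  (M : Type*) [AddCommGroup M] [LieRingModule (B ⋊⁅δ⁆ D) M]

/-- A module over `B ⋊ D`, where `B` is a Lie algebra over `A`, is `Q`-smooth if for every `z : B`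
each vector is annihilated by `Q ^ n • z` for large `n`. -/
def IsSmooth (Q : Ideal A) : Prop :=
  ∀ (z : B) (m : M), ∃ n, ∀ c ∈ Q ^ n, ⁅SemiDirectSum.inl δ (c • z), m⁆ = 0

variable {δ M}

lemma inl_lie_inl (y z : B) (m : M) : ⁅SemiDirectSum.inl δ y, ⁅SemiDirectSum.inl δ z, m⁆⁆ =
    ⁅SemiDirectSum.inl δ ⁅y, z⁆, m⁆ + ⁅SemiDirectSum.inl δ z, ⁅SemiDirectSum.inl δ y, m⁆⁆ := by
  rw [leibniz_lie, LieHom.map_lie]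

lemma inr_lie_inl (d : D) (z : B) (m : M) : ⁅SemiDirectSum.inr δ d, ⁅SemiDirectSum.inl δ z, m⁆⁆ =
    ⁅SemiDirectSum.inl δ (δ d z), m⁆ +
      ⁅SemiDirectSum.inl δ z, ⁅SemiDirectSum.inr δ d, m⁆⁆ := by
  rw [leibniz_lie, SemiDirect.lie_inr_inl]

/-- Smoothness of a cyclic module need only be checked on the generator. -/
lemma IsSmooth.of_gen {S : Set (UniversalEnvelopingAlgebra ℂ (B ⋊⁅δ⁆ D))} {Q : Ideal A}
    (hδ : ∀ d (a : A) z, δ d (a • z) = a • δ d z)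
    (h : ∀ z : B, ∃ n, ∀ c ∈ Q ^ n,
      ⁅SemiDirectSum.inl δ (c • z), CyclicModule.gen S⁆ = 0) :
    IsSmooth δ (CyclicModule S) Q := by
  let N : Submodule ℂ (CyclicModule S) :=
    { carrier := {m | ∀ z : B, ∃ n, ∀ c ∈ Q ^ n, ⁅SemiDirectSum.inl δ (c • z), m⁆ = 0}
      zero_mem' := fun z => ⟨0, fun c _ => lie_zero _⟩
      add_mem' := fun {m m'} hm hm' z => by
        obtain ⟨n, hn⟩ := hm z
        obtain ⟨n', hn'⟩ := hm' z
        refine ⟨n ⊔ n', fun c hc => ?_⟩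
        rw [lie_add, hn c (Ideal.pow_le_pow_right le_sup_left hc),
          hn' c (Ideal.pow_le_pow_right le_sup_right hc), add_zero]
      smul_mem' := fun r m hm z => by
        obtain ⟨n, hn⟩ := hm z
        exact ⟨n, fun c hc => by rw [lie_smul, hn c hc, smul_zero]⟩ }
  have hN : N = ⊤ := by
    refine CyclicModule.eq_top_of_lie_stable h fun x m hm z => ?_
    obtain ⟨n, hn⟩ := hm z
    obtain ⟨n₁, hn₁⟩ := hm ⁅z, x.left⁆
    obtain ⟨n₂, hn₂⟩ := hm (δ x.right z)
    refine ⟨n ⊔ (n₁ ⊔ n₂), fun c hc => ?_⟩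
    have h0 := hn c (Ideal.pow_le_pow_right le_sup_left hc)
    have h1 := hn₁ c (Ideal.pow_le_pow_right (le_sup_left.trans le_sup_right) hc)
    have h2 := hn₂ c (Ideal.pow_le_pow_right (le_sup_right.trans le_sup_right) hc)
    have h3 := inr_lie_inl (δ := δ) x.right (c • z) m
    rw [h0, lie_zero, hδ, h2, zero_add] at h3
    rw [← SemiDirect.inl_add_inr x, add_lie, lie_add, ← h3, add_zero, inl_lie_inl, h0, lie_zero,
      add_zero, smul_lie, h1]
  intro z m
  exact (hN ▸ Submodule.mem_top : m ∈ N) z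

variable {Q : Ideal A}

/-- A sequence in `A` that represents an element of the completion `lim A / Q ^ n`. -/
def IsAdicCauchy (Q : Ideal A) (e : ℕ → A) : Prop := ∀ n k, n ≤ k → e k - e n ∈ Q ^ n

lemma IsSmooth.exists_eventually (hM : IsSmooth δ M Q) {e : ℕ → A} (he : IsAdicCauchy Q e) (z : B)
    (m : M) : ∃ w, ∀ᶠ n in atTop, ⁅SemiDirectSum.inl δ (e n • z), m⁆ = w := by
  obtain ⟨n, hn⟩ := hM z m
  refine ⟨⁅SemiDirectSum.inl δ (e n • z), m⁆, (eventually_ge_atTop n).mono fun k hk => ?_⟩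
  rw [← sub_eq_zero, ← sub_lie, ← map_sub, ← sub_smul, hn _ (he n k hk)]

open Classical in
/-- The action of `e • z` on `m`, for `e` a sequence that converges in the completion of `A`: the
eventual value of `(e n • z) m`. It is zero by convention if there is no such value. -/
def adicAction (e : ℕ → A) (z : B) (m : M) : M :=
  if h : ∃ w, ∀ᶠ n in atTop, ⁅SemiDirectSum.inl δ (e n • z), m⁆ = w then h.choose else 0

lemma adicAction_eq_of_eventually {e : ℕ → A} {z : B} {m w : M}
    (h : ∀ᶠ n in atTop, ⁅SemiDirectSum.inl δ (e n • z), m⁆ = w) :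
    adicAction (δ := δ) e z m = w := by
  have h' : ∃ w, ∀ᶠ n in atTop, ⁅SemiDirectSum.inl δ (e n • z), m⁆ = w := ⟨w, h⟩
  rw [adicAction, dif_pos h']
  obtain ⟨n, h1, h2⟩ := (h'.choose_spec.and h).exists
  exact h1.symm.trans h2

lemma IsSmooth.eventually_adicAction (hM : IsSmooth δ M Q) {e : ℕ → A} (he : IsAdicCauchy Q e)
    (z : B) (m : M) :
    ∀ᶠ n in atTop, ⁅SemiDirectSum.inl δ (e n • z), m⁆ = adicAction (δ := δ) e z m := by
  obtain ⟨w, hw⟩ := hM.exists_eventually he z m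
  rwa [adicAction_eq_of_eventually hw]

lemma IsSmooth.eventually_eq_zero (hM : IsSmooth δ M Q) {g : ℕ → A} (hg : ∀ n, g n ∈ Q ^ n) (z : B)
    (m : M) : ∀ᶠ n in atTop, ⁅SemiDirectSum.inl δ (g n • z), m⁆ = 0 := by
  obtain ⟨n, hn⟩ := hM z m
  exact (eventually_ge_atTop n).mono fun k hk => hn _ (Ideal.pow_le_pow_right hk (hg k))

/-- `adicAction` as a family of operators that depends linearly on `z : B`. -/
def IsSmooth.adicEnd [Module ℂ M] [LieModule ℂ (B ⋊⁅δ⁆ D) M] [Algebra ℂ A] [IsScalarTower ℂ A B]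
    (hM : IsSmooth δ M Q) {e : ℕ → A}
    (he : IsAdicCauchy Q e) : B →ₗ[ℂ] Module.End ℂ M :=
  LinearMap.mk₂ ℂ (adicAction (δ := δ) e)
    (fun z z' m => adicAction_eq_of_eventually <| by
      filter_upwards [hM.eventually_adicAction he z m, hM.eventually_adicAction he z' m] with n h h'
      rw [smul_add, map_add, add_lie, h, h'])
    (fun c z m => adicAction_eq_of_eventually <| by
      filter_upwards [hM.eventually_adicAction he z m] with n h
      have : e n • c • z = c • e n • z := by
        rw [← algebraMap_smul A c z, ← algebraMap_smul A c (e n • z), smul_smul, smul_smul,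
          mul_comm]
      rw [this, map_smul, smul_lie, h])
    (fun z m m' => adicAction_eq_of_eventually <| by
      filter_upwards [hM.eventually_adicAction he z m, hM.eventually_adicAction he z m'] with n h h'
      rw [lie_add, h, h'])
    (fun c z m => adicAction_eq_of_eventually <| by
      filter_upwards [hM.eventually_adicAction he z m] with n h
      rw [lie_smul, h])

section Module

variable [Module ℂ M] [LieModule ℂ (B ⋊⁅δ⁆ D) M] [Algebra ℂ A] [IsScalarTower ℂ A B]
  (hM : IsSmooth δ M Q) {e f : ℕ → A} (he : IsAdicCauchy Q e) (hf : IsAdicCauchy Q f)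

include hM he in
lemma IsSmooth.eventually_adicEnd (z : B) (m : M) :
    ∀ᶠ n in atTop, ⁅SemiDirectSum.inl δ (e n • z), m⁆ = hM.adicEnd he z m :=
  hM.eventually_adicAction he z m

lemma IsSmooth.adicEnd_eq_of_eventually {z : B} {m w : M}
    (h : ∀ᶠ n in atTop, ⁅SemiDirectSum.inl δ (e n • z), m⁆ = w) : hM.adicEnd he z m = w :=
  adicAction_eq_of_eventually h

/-- In the completion, `[e • y, f • z] = (e f) • [y, z]`. -/
lemma IsSmooth.eventually_lie_adicEnd (y z : B) (m : M) :
    ∀ᶠ n in atTop, ⁅hM.adicEnd he y, hM.adicEnd hf z⁆ m =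
      ⁅SemiDirectSum.inl δ ((e n * f n) • ⁅y, z⁆), m⁆ := by
  filter_upwards [hM.eventually_adicEnd he y m, hM.eventually_adicEnd hf z m,
    hM.eventually_adicEnd he y (hM.adicEnd hf z m),
    hM.eventually_adicEnd hf z (hM.adicEnd he y m)] with n h₁ h₂ h₃ h₄
  rw [LieRing.of_associative_ring_bracket, LinearMap.sub_apply, Module.End.mul_apply,
    Module.End.mul_apply, ← h₃, ← h₄, ← h₁, ← h₂, ← lie_lie, ← LieHom.map_lie, smul_lie, lie_smul,
    smul_smul]

/-- The operators of an idempotent of the completion form a representation of `B`. -/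
def IsSmooth.adicRep (hidem : ∀ n, e n * e n - e n ∈ Q ^ n) : B →ₗ⁅ℂ⁆ Module.End ℂ M :=
  { hM.adicEnd he with
    map_lie' := fun {y z} => by
      refine LinearMap.ext fun m => hM.adicEnd_eq_of_eventually he ?_
      filter_upwards [hM.eventually_lie_adicEnd he he y z m,
        hM.eventually_eq_zero hidem ⁅y, z⁆ m] with n h h'
      rw [sub_smul, map_sub, sub_lie, sub_eq_zero] at h'
      exact h'.symm.trans h.symm }

/-- The operators of orthogonal elements of the completion commute. -/
lemma IsSmooth.adicEnd_comm (horth : ∀ n, e n * f n ∈ Q ^ n) (y z : B) (m : M) :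
    hM.adicEnd he y (hM.adicEnd hf z m) = hM.adicEnd hf z (hM.adicEnd he y m) := by
  obtain ⟨n, h, h'⟩ := ((hM.eventually_lie_adicEnd he hf y z m).and
    (hM.eventually_eq_zero horth ⁅y, z⁆ m)).exists
  rw [h', LieRing.of_associative_ring_bracket, LinearMap.sub_apply, sub_eq_zero] at h
  exact h

lemma IsSmooth.adicEnd_add (hef : ∀ n, e n + f n = 1) (z : B) (m : M) :
    hM.adicEnd he z m + hM.adicEnd hf z m = ⁅SemiDirectSum.inl δ z, m⁆ := by
  obtain ⟨n, h, h'⟩ := ((hM.eventually_adicEnd he z m).and (hM.eventually_adicEnd hf z m)).exists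
  rw [← h, ← h', ← add_lie, ← map_add, ← add_smul, hef, one_smul]

lemma IsSmooth.inr_lie_adicEnd (hδ : ∀ d (a : A) z, δ d (a • z) = a • δ d z) (d : D) (z : B)
    (m : M) : ⁅SemiDirectSum.inr δ d, hM.adicEnd he z m⁆ =
      hM.adicEnd he (δ d z) m + hM.adicEnd he z ⁅SemiDirectSum.inr δ d, m⁆ := by
  obtain ⟨n, h₁, h₂, h₃⟩ := ((hM.eventually_adicEnd he z m).and
    ((hM.eventually_adicEnd he (δ d z) m).and
      (hM.eventually_adicEnd he z ⁅SemiDirectSum.inr δ d, m⁆))).exists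
  rw [← h₁, ← h₂, ← h₃, inr_lie_inl, hδ]

end Module

end Smooth

/-! ### Generators of the derived algebra -/

section Derived

variable {ι : Type*} [Fintype ι] {C : Matrix ι ι ℤ}
  {𝔥 : Type*} [AddCommGroup 𝔥] [Module ℂ 𝔥] (R : Realization C 𝔥)

lemma lie_H_H (x y : 𝔥) : ⁅H R x, H R y⁆ = 0 := by
  have h := congrArg (KMAlgebra.mk R) (Aux.mk_eq_zero_of_rel R (Rel.hh (R := R) x y))
  rwa [LieHom.map_lie, LieHom.map_lie, map_zero] at h

lemma lie_H_E (x : 𝔥) (i : ι) : ⁅H R x, E R i⁆ = R.root i x • E R i := by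
  have h := congrArg (KMAlgebra.mk R) (Aux.mk_eq_zero_of_rel R (Rel.he (R := R) x i))
  rwa [map_sub, LieHom.map_lie, map_sub, LieHom.map_lie, map_smul, map_smul, map_zero,
    sub_eq_zero] at h

lemma lie_H_F (x : 𝔥) (i : ι) : ⁅H R x, F R i⁆ = -(R.root i x • F R i) := by
  have h := congrArg (KMAlgebra.mk R) (Aux.mk_eq_zero_of_rel R (Rel.hf (R := R) x i))
  rwa [map_add, LieHom.map_lie, map_add, LieHom.map_lie, map_smul, map_smul, map_zero,
    add_eq_zero_iff_eq_neg] at h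

/-- The subalgebra generated by the Chevalley generators `e_i`, `f_i`. -/
def chevalley : LieSubalgebra ℂ (KMAlgebra R) :=
  LieSubalgebra.lieSpan ℂ (KMAlgebra R) (Set.range (E R) ∪ Set.range (F R))

lemma E_mem_chevalley (i : ι) : E R i ∈ chevalley R :=
  LieSubalgebra.subset_lieSpan (Or.inl ⟨i, rfl⟩)

lemma F_mem_chevalley (i : ι) : F R i ∈ chevalley R :=
  LieSubalgebra.subset_lieSpan (Or.inr ⟨i, rfl⟩)

lemma lie_H_mem_chevalley (t : 𝔥) {x : KMAlgebra R} (hx : x ∈ chevalley R) :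
    ⁅H R t, x⁆ ∈ chevalley R := by
  let N : LieSubalgebra ℂ (KMAlgebra R) :=
    { carrier := {x | x ∈ chevalley R ∧ ⁅H R t, x⁆ ∈ chevalley R}
      zero_mem' := ⟨zero_mem _, by rw [lie_zero]; exact zero_mem _⟩
      add_mem' := fun {x y} hx hy => ⟨add_mem hx.1 hy.1, by
        rw [lie_add]; exact add_mem hx.2 hy.2⟩
      smul_mem' := fun c x hx => ⟨(chevalley R).smul_mem c hx.1, by
        rw [lie_smul]; exact (chevalley R).smul_mem c hx.2⟩
      lie_mem' := fun {x y} hx hy => ⟨(chevalley R).lie_mem hx.1 hy.1, by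
        rw [leibniz_lie]
        exact add_mem ((chevalley R).lie_mem hx.2 hy.1) ((chevalley R).lie_mem hx.1 hy.2)⟩ }
  have h : chevalley R ≤ N := by
    refine LieSubalgebra.lieSpan_le.2 ?_
    rintro _ (⟨i, rfl⟩ | ⟨i, rfl⟩)
    · refine ⟨E_mem_chevalley R i, ?_⟩
      rw [lie_H_E]
      exact (chevalley R).smul_mem _ (E_mem_chevalley R i)
    · refine ⟨F_mem_chevalley R i, ?_⟩
      rw [lie_H_F]
      exact neg_mem ((chevalley R).smul_mem _ (F_mem_chevalley R i))
  exact (h hx).2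

/-- `𝔤` is the sum of `𝔥` and the subalgebra generated by the `e_i`, `f_i`. -/
lemma exists_eq_H_add_chevalley (x : KMAlgebra R) : ∃ t, ∃ s ∈ chevalley R, x = H R t + s := by
  let N : LieSubalgebra ℂ (KMAlgebra R) :=
    { carrier := {x | ∃ t, ∃ s ∈ chevalley R, x = H R t + s}
      zero_mem' := ⟨0, 0, zero_mem _, by rw [map_zero, add_zero]⟩
      add_mem' := by
        rintro _ _ ⟨t, s, hs, rfl⟩ ⟨t', s', hs', rfl⟩
        exact ⟨t + t', s + s', add_mem hs hs', by rw [map_add]; abel⟩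
      smul_mem' := by
        rintro c _ ⟨t, s, hs, rfl⟩
        exact ⟨c • t, c • s, (chevalley R).smul_mem c hs, by rw [map_smul, smul_add]⟩
      lie_mem' := by
        rintro _ _ ⟨t, s, hs, rfl⟩ ⟨t', s', hs', rfl⟩
        refine ⟨0, ⁅H R t, s'⁆ - ⁅H R t', s⁆ + ⁅s, s'⁆, add_mem (sub_mem
          (lie_H_mem_chevalley R t hs') (lie_H_mem_chevalley R t' hs))
          ((chevalley R).lie_mem hs hs'), ?_⟩
        rw [map_zero, add_lie, lie_add, lie_add, lie_H_H, ← lie_skew s (H R t')]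
        abel }
  let π : FreeLieAlgebra ℂ (Gen ι 𝔥) →ₗ⁅ℂ⁆ KMAlgebra R := (KMAlgebra.mk R).comp (Aux.mk R)
  have hgen : ∀ g : Gen ι 𝔥, π (FreeLieAlgebra.of ℂ g) ∈ N := by
    rintro (t | i | i)
    · exact ⟨t, 0, zero_mem _, (add_zero _).symm⟩
    · exact ⟨0, E R i, E_mem_chevalley R i, by rw [map_zero, zero_add]; rfl⟩
    · exact ⟨0, F R i, F_mem_chevalley R i, by rw [map_zero, zero_add]; rfl⟩
  have hπ : N.incl.comp (FreeLieAlgebra.lift ℂ fun g => (⟨_, hgen g⟩ : N)) = π := by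
    ext g
    simp
  obtain ⟨y, rfl⟩ : ∃ y, π y = x := by
    obtain ⟨y, rfl⟩ := Submodule.Quotient.mk_surjective _ x
    obtain ⟨z, rfl⟩ := Submodule.Quotient.mk_surjective _ y
    exact ⟨z, rfl⟩
  rw [← hπ]
  exact (FreeLieAlgebra.lift ℂ (fun g => (⟨_, hgen g⟩ : N)) y).2

lemma derived_le_chevalley {x : KMAlgebra R} (hx : x ∈ derived R) : x ∈ chevalley R := by
  rw [← LieSubmodule.mem_toSubmodule, LieSubmodule.lieIdeal_oper_eq_linear_span] at hx
  refine Submodule.span_le (p := (chevalley R).toSubmodule).2 ?_ hx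
  rintro _ ⟨⟨x, -⟩, ⟨y, -⟩, rfl⟩
  obtain ⟨t, s, hs, rfl⟩ := exists_eq_H_add_chevalley R x
  obtain ⟨t', s', hs', rfl⟩ := exists_eq_H_add_chevalley R y
  change ⁅H R t + s, H R t' + s'⁆ ∈ chevalley R
  rw [add_lie, lie_add, lie_add, lie_H_H, zero_add, ← lie_skew s (H R t')]
  exact add_mem (lie_H_mem_chevalley R t hs') (add_mem (neg_mem (lie_H_mem_chevalley R t' hs))
    ((chevalley R).lie_mem hs hs'))

variable {R}

lemma lie_mem_derived (x y : KMAlgebra R) : ⁅x, y⁆ ∈ derived R :=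
  LieSubmodule.lie_mem_lie (LieSubmodule.mem_top _) (LieSubmodule.mem_top _)

lemma root_coroot_self (hC : IsGeneralizedCartan C) (i : ι) : R.root i (R.coroot i) = 2 := by
  rw [R.pairing, hC.diag]; norm_num

lemma E_mem_derived (hC : IsGeneralizedCartan C) (i : ι) : E R i ∈ derived R := by
  have h : E R i = (2⁻¹ : ℂ) • ⁅H R (R.coroot i), E R i⁆ := by
    rw [lie_H_E, root_coroot_self hC, smul_smul]; norm_num
  rw [h]
  exact (derived R).smul_mem _ (lie_mem_derived _ _)

lemma F_mem_derived (hC : IsGeneralizedCartan C) (i : ι) : F R i ∈ derived R := by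
  have h : F R i = (-2⁻¹ : ℂ) • ⁅H R (R.coroot i), F R i⁆ := by
    rw [lie_H_F, root_coroot_self hC, smul_neg, smul_smul]; norm_num
  rw [h]
  exact (derived R).smul_mem _ (lie_mem_derived _ _)

/-- A Lie subalgebra of `𝔤'` that contains all `e_i` and `f_i` is everything. -/
lemma eq_top_of_E_F_mem (hC : IsGeneralizedCartan C) {N : LieSubalgebra ℂ (derived R)}
    (hE : ∀ i, ⟨E R i, E_mem_derived hC i⟩ ∈ N) (hF : ∀ i, ⟨F R i, F_mem_derived hC i⟩ ∈ N)
    (X : derived R) : X ∈ N := by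
  have h : chevalley R ≤ N.map (derived R).incl := by
    refine LieSubalgebra.lieSpan_le.2 ?_
    rintro _ (⟨i, rfl⟩ | ⟨i, rfl⟩)
    · exact ⟨_, hE i, rfl⟩
    · exact ⟨_, hF i, rfl⟩
  obtain ⟨Y, hY, hYX⟩ := h (derived_le_chevalley R X.2)
  have : Y = X := Subtype.ext hYX
  exact this ▸ hY

lemma lie_H_mem_rootSpace (t : 𝔥) {γ : Module.Dual ℂ 𝔥} {x : KMAlgebra R}
    (hx : x ∈ rootSpace R γ) : ⁅H R t, x⁆ ∈ rootSpace R γ := by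
  rw [hx t]
  exact (rootSpace R γ).smul_mem _ hx

lemma lie_H_mem_nPlus (t : 𝔥) {x : KMAlgebra R} (hx : x ∈ nPlus R) : ⁅H R t, x⁆ ∈ nPlus R := by
  have h : nPlus R ≤ (nPlus R).comap (LieModule.toEnd ℂ (KMAlgebra R) (KMAlgebra R) (H R t)) :=
    iSup₂_le fun α hα y hy =>
      le_iSup₂ (f := fun α (_ : α ∈ positiveRoots R) => rootSpace R (rootOf R α)) α hα
        (lie_H_mem_rootSpace t hy)
  exact h hx

lemma lie_H_derivedCartan (t : 𝔥) {x : KMAlgebra R} (hx : x ∈ derivedCartan R) :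
    ⁅H R t, x⁆ = 0 := by
  have h : derivedCartan R ≤ LinearMap.ker (LieModule.toEnd ℂ (KMAlgebra R) (KMAlgebra R)
      (H R t)) := by
    refine Submodule.span_le.2 ?_
    rintro _ ⟨i, rfl⟩
    exact lie_H_H R t _
  exact h hx

open Classical in
lemma rootOf_single (i : ι) : rootOf R (Pi.single i 1) = R.root i := by
  rw [rootOf, Finset.sum_eq_single i] <;> simp +contextual

open Classical in
lemma single_mem_positiveRoots {i : ι} (h : E R i ≠ 0) :
    (Pi.single i 1 : ι → ℕ) ∈ positiveRoots R := by
  refine ⟨by simp, fun hbot => h ?_⟩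
  have : E R i ∈ rootSpace R (rootOf R (Pi.single i 1)) := fun t => by
    rw [rootOf_single, lie_H_E]
  rwa [hbot, Submodule.mem_bot] at this

lemma E_mem_nPlus (i : ι) : E R i ∈ nPlus R := by
  classical
  by_cases h : E R i = 0
  · rw [h]; exact zero_mem _
  · exact le_iSup₂ (f := fun α (_ : α ∈ positiveRoots R) => rootSpace R (rootOf R α)) _
      (single_mem_positiveRoots h) fun t => by rw [rootOf_single, lie_H_E]

open Classical in
lemma F_mem_rootSpace (i : ι) : F R i ∈ rootSpace R (-rootOf R (Pi.single i 1)) := fun t => by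
  rw [rootOf_single, lie_H_F, LinearMap.neg_apply, neg_smul]

lemma F_eq_zero_of_E_eq_zero (hC : IsGeneralizedCartan C) {i : ι} (h : E R i = 0) :
    F R i = 0 := by
  have h' := lie_H_F R (R.coroot i) i
  rw [← lie_E_F, h, zero_lie, zero_lie, root_coroot_self hC, eq_comm, neg_eq_zero] at h'
  exact (smul_eq_zero.1 h').resolve_left two_ne_zero

end Derived

/-! ### Highest weight modules over the loop algebra -/

section HighestWeight

variable {ι : Type*} [Fintype ι] {C : Matrix ι ι ℤ}
  {𝔥 : Type*} [AddCommGroup 𝔥] [Module ℂ 𝔥] {R : Realization C 𝔥}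
  {A : Type*} [CommRing A] [Algebra ℂ A] {𝔥₂ : LieSubalgebra ℂ (KMAlgebra R)}
  (ψ : Module.Dual ℂ (LoopCartan R A 𝔥₂)) (K : positiveRoots R → Ideal A)

lemma loopAction_tmul (y : 𝔥₂) (a : A) (X : derived R) :
    loopAction R A 𝔥₂ y (a ⊗ₜ[ℂ] X) = a ⊗ₜ[ℂ] ⁅(y : KMAlgebra R), X⁆ := rfl

lemma loopAction_smul (y : 𝔥₂) (a : A) (z : A ⊗[ℂ] derived R) :
    loopAction R A 𝔥₂ y (a • z) = a • loopAction R A 𝔥₂ y z := by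
  induction z using TensorProduct.induction_on with
  | zero => simp
  | add z w hz hw => rw [smul_add, map_add, map_add, hz, hw, smul_add]
  | tmul b X =>
    rw [TensorProduct.smul_tmul', loopAction_tmul, loopAction_tmul, TensorProduct.smul_tmul']

/-- The inclusion `𝔥' ⊗ A → 𝔤' ⊗ A`. -/
def cartanTensor (R : Realization C 𝔥) (A : Type*) [CommRing A] [Algebra ℂ A] :
    A ⊗[ℂ] derivedCartan R →ₗ[ℂ] A ⊗[ℂ] derived R :=
  (Submodule.inclusion (derivedCartan_le R)).lTensor A

lemma loopCartanMap_eq (z : A ⊗[ℂ] derivedCartan R) (y : 𝔥₂) :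
    loopCartanMap R A 𝔥₂ (z, y) = SemiDirectSum.inl (loopAction R A 𝔥₂) (cartanTensor R A z) +
      SemiDirectSum.inr (loopAction R A 𝔥₂) y :=
  (SemiDirect.inl_add_inr _).symm

lemma IsCartanComplement.exists_H_eq (h : IsCartanComplement R 𝔥₂) (y : 𝔥₂) :
    ∃ t, H R t = y := by
  have : (y : KMAlgebra R) ∈ LinearMap.range (H R) := h.sup_eq ▸
    (le_sup_right : 𝔥₂.toSubmodule ≤ derivedCartan R ⊔ 𝔥₂.toSubmodule) y.2
  exact this

lemma IsCartanComplement.lie_eq_zero (h : IsCartanComplement R 𝔥₂) (y y' : 𝔥₂) : ⁅y, y'⁆ = 0 := by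
  obtain ⟨t, ht⟩ := h.exists_H_eq y
  obtain ⟨t', ht'⟩ := h.exists_H_eq y'
  apply Subtype.ext
  rw [LieSubalgebra.coe_bracket, ← ht, ← ht', lie_H_H]
  rfl

/-- `LoopRel ψ K z c`: the relation `z v = c v`, with `z` a pure tensor in `𝔤' ⊗ A`, is one of
those that define `M(ψ, K)`. The remaining defining relations are `y v = ψ(y) v`, `y ∈ 𝔥''`. -/
inductive LoopRel : A ⊗[ℂ] derived R → ℂ → Prop
  | nPlus (X : derived R) (hX : (X : KMAlgebra R) ∈ nPlus R) (a : A) : LoopRel (a ⊗ₜ[ℂ] X) 0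
  | cartan (x : derivedCartan R) (a : A) :
      LoopRel (a ⊗ₜ[ℂ] Submodule.inclusion (derivedCartan_le R) x) (ψ (a ⊗ₜ[ℂ] x, 0))
  | root (β : positiveRoots R) (X : derived R)
      (hX : (X : KMAlgebra R) ∈ rootSpace R (-rootOf R β)) (a : A) (ha : a ∈ K β) :
      LoopRel (a ⊗ₜ[ℂ] X) 0

variable {ψ K}

/-- The action of `𝔥''` takes a defining relation to a defining relation with eigenvalue zero. -/
lemma LoopRel.lie_inr (h𝔥₂ : IsCartanComplement R 𝔥₂) {z : A ⊗[ℂ] derived R} {c : ℂ}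
    (h : LoopRel ψ K z c) (y : 𝔥₂) : LoopRel ψ K (loopAction R A 𝔥₂ y z) 0 := by
  obtain ⟨t, ht⟩ := h𝔥₂.exists_H_eq y
  cases h with
  | nPlus X hX a =>
    refine LoopRel.nPlus _ ?_ a
    change ⁅(y : KMAlgebra R), (X : KMAlgebra R)⁆ ∈ KacMoody.nPlus R
    rw [← ht]
    exact lie_H_mem_nPlus t hX
  | cartan x a =>
    refine LoopRel.nPlus _ ?_ a
    change ⁅(y : KMAlgebra R), (x : KMAlgebra R)⁆ ∈ KacMoody.nPlus R
    rw [← ht, lie_H_derivedCartan t x.2]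
    exact zero_mem _
  | root β X hX a ha =>
    refine LoopRel.root β _ ?_ a ha
    change ⁅(y : KMAlgebra R), (X : KMAlgebra R)⁆ ∈ rootSpace R (-rootOf R β)
    rw [← ht]
    exact lie_H_mem_rootSpace t hX

namespace HWModule

/-- The highest weight vector of `M(ψ, K)`. -/
abbrev hwv (ψ : Module.Dual ℂ (LoopCartan R A 𝔥₂)) (K : positiveRoots R → Ideal A) :
    HWModule R ψ K :=
  CyclicModule.gen _

lemma lie_inl_hwv {z : A ⊗[ℂ] derived R} {c : ℂ} (h : LoopRel ψ K z c) :
    ⁅SemiDirectSum.inl (loopAction R A 𝔥₂) z, hwv ψ K⁆ = c • hwv ψ K := by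
  cases h with
  | nPlus X hX a =>
    rw [zero_smul]
    exact CyclicModule.lie_gen_eq_zero (HWRel.nPlus X hX a)
  | cartan x a =>
    exact CyclicModule.lie_gen_eq_smul (HWRel.weight (a ⊗ₜ[ℂ] x, 0))
  | root β X hX a ha =>
    rw [zero_smul]
    exact CyclicModule.lie_gen_eq_zero (HWRel.root β X hX a ha)

lemma lie_inr_hwv (y : 𝔥₂) :
    ⁅SemiDirectSum.inr (loopAction R A 𝔥₂) y, hwv ψ K⁆ = ψ (0, y) • hwv ψ K := by
  have h : SemiDirectSum.inr (loopAction R A 𝔥₂) y = loopCartanMap R A 𝔥₂ (0, y) := by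
    rw [loopCartanMap_eq, map_zero, map_zero, zero_add]
  rw [h]
  exact CyclicModule.lie_gen_eq_smul (HWRel.weight (0, y))

/-- The universal property of `M(ψ, K)`. -/
lemma exists_lift {V : Type*} [AddCommGroup V] [Module ℂ V]
    (ρ : LoopAlgebra R A 𝔥₂ →ₗ⁅ℂ⁆ Module.End ℂ V) (v : V)
    (hinl : ∀ z c, LoopRel ψ K z c → ρ (SemiDirectSum.inl (loopAction R A 𝔥₂) z) v = c • v)
    (hinr : ∀ y, ρ (SemiDirectSum.inr (loopAction R A 𝔥₂) y) v = ψ (0, y) • v) :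
    ∃ f : HWModule R ψ K →ₗ[ℂ] V, f (hwv ψ K) = v ∧ ∀ x m, f ⁅x, m⁆ = ρ x (f m) := by
  refine CyclicModule.exists_lift ρ v ?_
  rintro s (⟨X, hX, a⟩ | ⟨⟨z, y⟩⟩ | ⟨β, X, hX, a, ha⟩)
  · rw [UniversalEnvelopingAlgebra.lift_ι_apply]
    exact (hinl _ _ (LoopRel.nPlus X hX a)).trans (zero_smul _ _)
  · rw [map_sub, UniversalEnvelopingAlgebra.lift_ι_apply, AlgHom.commutes, LinearMap.sub_apply,
      Module.algebraMap_end_apply, sub_eq_zero]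
    have hz : ρ (SemiDirectSum.inl (loopAction R A 𝔥₂) (cartanTensor R A z)) v =
        ψ (z, 0) • v := by
      induction z using TensorProduct.induction_on with
      | zero =>
        rw [map_zero, map_zero, map_zero, LinearMap.zero_apply,
          Prod.mk_zero_zero, map_zero,
          zero_smul]
      | tmul a x => exact hinl _ _ (LoopRel.cartan x a)
      | add z w hz hw =>
        have : ((z + w, 0) : LoopCartan R A 𝔥₂) = (z, 0) + (w, 0) := by
          rw [Prod.mk_add_mk, add_zero]
        rw [this, map_add, map_add, map_add, LinearMap.add_apply, hz, hw, map_add, add_smul]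
    have h' : ((z, y) : LoopCartan R A 𝔥₂) = (z, 0) + (0, y) := by
      rw [Prod.mk_add_mk, add_zero, zero_add]
    rw [loopCartanMap_eq, map_add, LinearMap.add_apply, hz, hinr, h', map_add, add_smul]
  · rw [UniversalEnvelopingAlgebra.lift_ι_apply]
    exact (hinl _ _ (LoopRel.root β X hX a ha)).trans (zero_smul _ _)

lemma eq_top_of_stable {N : Submodule ℂ (HWModule R ψ K)} (hgen : hwv ψ K ∈ N)
    (hinl : ∀ z, ∀ m ∈ N, ⁅SemiDirectSum.inl (loopAction R A 𝔥₂) z, m⁆ ∈ N)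
    (hinr : ∀ y, ∀ m ∈ N, ⁅SemiDirectSum.inr (loopAction R A 𝔥₂) y, m⁆ ∈ N) : N = ⊤ :=
  CyclicModule.eq_top_of_lie_stable hgen fun x m hm => by
    rw [← SemiDirect.inl_add_inr x, add_lie]
    exact N.add_mem (hinl _ m hm) (hinr _ m hm)

/-- `M(ψ, K)` is `Q`-smooth if every `K β` contains a power of `Q`. The elements `X ∈ 𝔤'` for which
`X ⊗ Q ^ n` annihilates the highest weight vector for some `n` form a Lie subalgebra, which contains
the Chevalley generators. -/
lemma isSmooth (hC : IsGeneralizedCartan C) {Q : Ideal A} (hQ : ∀ β, ∃ n, Q ^ n ≤ K β) :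
    IsSmooth (loopAction R A 𝔥₂) (HWModule R ψ K) Q := by
  classical
  refine IsSmooth.of_gen loopAction_smul fun z => ?_
  let N : LieSubalgebra ℂ (derived R) :=
    { carrier := {X | ∃ n, ∀ c ∈ Q ^ n, ⁅loopElt R A 𝔥₂ X c, hwv ψ K⁆ = 0}
      zero_mem' := ⟨0, fun c _ => by
        rw [loopElt, TensorProduct.tmul_zero, map_zero, zero_lie]⟩
      add_mem' := by
        rintro X Y ⟨n, hn⟩ ⟨n', hn'⟩
        refine ⟨n ⊔ n', fun c hc => ?_⟩
        have h := hn c (Ideal.pow_le_pow_right le_sup_left hc)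
        have h' := hn' c (Ideal.pow_le_pow_right le_sup_right hc)
        rw [loopElt] at h h' ⊢
        rw [TensorProduct.tmul_add, map_add, add_lie, h, h', add_zero]
      smul_mem' := by
        rintro r X ⟨n, hn⟩
        refine ⟨n, fun c hc => ?_⟩
        have h := hn c hc
        rw [loopElt] at h ⊢
        rw [TensorProduct.tmul_smul, map_smul, smul_lie, h, smul_zero]
      lie_mem' := by
        rintro X Y ⟨n, hn⟩ ⟨n', hn'⟩
        refine ⟨n + n', fun c hc => ?_⟩
        rw [pow_add] at hc
        induction hc using Submodule.mul_induction_on' with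
        | mem_mul_mem a ha b hb =>
          have : loopElt R A 𝔥₂ ⁅X, Y⁆ (a * b) = ⁅loopElt R A 𝔥₂ X a, loopElt R A 𝔥₂ Y b⁆ := by
            rw [loopElt, loopElt, loopElt, ← LieHom.map_lie, ExtendScalars.bracket_tmul]
          rw [this, lie_lie, hn a ha, hn' b hb, lie_zero, lie_zero, sub_zero]
        | add a _ b _ ha hb =>
          rw [loopElt] at ha hb ⊢
          rw [TensorProduct.add_tmul, map_add, add_lie, ha, hb, add_zero] }
  have hN : ∀ X, X ∈ N := by
    refine eq_top_of_E_F_mem hC (fun i => ⟨0, fun c _ => ?_⟩) fun i => ?_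
    · exact CyclicModule.lie_gen_eq_zero (HWRel.nPlus _ (E_mem_nPlus i) c)
    · by_cases h : E R i = 0
      · have h0 : (⟨F R i, F_mem_derived hC i⟩ : derived R) = 0 :=
          Subtype.ext (F_eq_zero_of_E_eq_zero hC h)
        rw [h0]
        exact zero_mem N
      · obtain ⟨n, hn⟩ := hQ ⟨_, single_mem_positiveRoots h⟩
        exact ⟨n, fun c hc => CyclicModule.lie_gen_eq_zero
          (HWRel.root ⟨_, single_mem_positiveRoots h⟩ _ (F_mem_rootSpace i) c (hn hc))⟩
  induction z using TensorProduct.induction_on with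
  | zero => exact ⟨0, fun c _ => by rw [smul_zero, map_zero, zero_lie]⟩
  | tmul a X =>
    obtain ⟨n, hn⟩ := hN X
    exact ⟨n, fun c hc => hn (c * a) (Ideal.mul_mem_right a _ hc)⟩
  | add z w hz hw =>
    obtain ⟨n, hn⟩ := hz
    obtain ⟨n', hn'⟩ := hw
    refine ⟨n ⊔ n', fun c hc => ?_⟩
    rw [smul_add, map_add, add_lie, hn c (Ideal.pow_le_pow_right le_sup_left hc),
      hn' c (Ideal.pow_le_pow_right le_sup_right hc), add_zero]

end HWModule

end HighestWeight

/-! ### Idempotents of the completion for coprime ideals -/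

section Coprime

variable {A : Type*} [CommRing A] {I J : Ideal A}

lemma exists_seq_of_isCoprime (h : IsCoprime I J) :
    ∃ e : ℕ → A, ∀ n, e n ∈ J ^ n ∧ 1 - e n ∈ I ^ n := by
  have (n : ℕ) : ∃ x ∈ J ^ n, 1 - x ∈ I ^ n := by
    obtain ⟨i, hi, j, hj, hij⟩ := Ideal.isCoprime_iff_exists.1 (h.pow (m := n) (n := n))
    exact ⟨j, hj, by rwa [← hij, add_sub_cancel_right]⟩
  choose e he using this
  exact ⟨e, he⟩

lemma mem_inf_pow_of_isCoprime (h : IsCoprime I J) {n : ℕ} {x : A} (hI : x ∈ I ^ n)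
    (hJ : x ∈ J ^ n) : x ∈ (I ⊓ J) ^ n := by
  rw [← Ideal.mul_eq_inf_of_isCoprime h, mul_pow, Ideal.mul_eq_inf_of_isCoprime h.pow]
  exact ⟨hI, hJ⟩

lemma isAdicCauchy_of_isCoprime (h : IsCoprime I J) {e : ℕ → A}
    (he : ∀ n, e n ∈ J ^ n ∧ 1 - e n ∈ I ^ n) : IsAdicCauchy (I ⊓ J) e := by
  intro n k hnk
  refine mem_inf_pow_of_isCoprime h ?_
    (sub_mem (Ideal.pow_le_pow_right hnk (he k).1) (he n).1)
  have := sub_mem (he n).2 (Ideal.pow_le_pow_right hnk (he k).2)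
  rwa [sub_sub_sub_cancel_left] at this

lemma mul_one_sub_mem_of_isCoprime (h : IsCoprime I J) {e : ℕ → A}
    (he : ∀ n, e n ∈ J ^ n ∧ 1 - e n ∈ I ^ n) (n : ℕ) : e n * (1 - e n) ∈ (I ⊓ J) ^ n :=
  mem_inf_pow_of_isCoprime h (Ideal.mul_mem_left _ _ (he n).2) (Ideal.mul_mem_right _ _ (he n).1)

lemma mul_self_sub_mem_of_isCoprime (h : IsCoprime I J) {e : ℕ → A}
    (he : ∀ n, e n ∈ J ^ n ∧ 1 - e n ∈ I ^ n) (n : ℕ) : e n * e n - e n ∈ (I ⊓ J) ^ n := by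
  have := neg_mem (mul_one_sub_mem_of_isCoprime h he n)
  rwa [mul_sub, mul_one, neg_sub] at this

end Coprime

/-! ### Splitting off tensor factors -/

section Splitting

variable {A : Type*} [CommRing A] [Algebra ℂ A] {B D : Type*} [LieRing B] [LieAlgebra ℂ B]
  [LieAlgebra A B] [IsScalarTower ℂ A B] [LieRing D] [LieAlgebra ℂ D]
  {δ : D →ₗ⁅ℂ⁆ LieDerivation ℂ B B}
  {M : Type*} [AddCommGroup M] [Module ℂ M] [LieRingModule (B ⋊⁅δ⁆ D) M]
  [LieModule ℂ (B ⋊⁅δ⁆ D) M]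
  {N : Type*} [AddCommGroup N] [Module ℂ N] [LieRingModule (B ⋊⁅δ⁆ D) N]
  [LieModule ℂ (B ⋊⁅δ⁆ D) N] {Q : Ideal A} {e : ℕ → A}

/-- The representation of `B ⋊ D` on `M` in which `B` acts through an idempotent of the completion
of `A`, and the action of the abelian algebra `D` is shifted by the functional `χ`. -/
def IsSmooth.shiftedRep (hM : IsSmooth δ M Q) (he : IsAdicCauchy Q e)
    (hidem : ∀ n, e n * e n - e n ∈ Q ^ n) (hδ : ∀ d (a : A) z, δ d (a • z) = a • δ d z)
    (hD : ∀ d d' : D, ⁅d, d'⁆ = 0) (χ : Module.Dual ℂ D) :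
    (B ⋊⁅δ⁆ D) →ₗ⁅ℂ⁆ Module.End ℂ M :=
  SemiDirect.lift (hM.adicRep he hidem)
    { toFun := fun d => LieModule.toEnd ℂ (B ⋊⁅δ⁆ D) M (SemiDirectSum.inr δ d) -
        χ d • (1 : Module.End ℂ M)
      map_add' := fun d d' => by rw [map_add, map_add, map_add, add_smul]; abel
      map_smul' := fun c d => by
        rw [map_smul, map_smul, map_smul, smul_sub, smul_assoc, RingHom.id_apply]
      map_lie' := fun {d d'} => LinearMap.ext fun m => by
        have h : ⁅SemiDirectSum.inr δ d, ⁅SemiDirectSum.inr δ d', m⁆⁆ =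
            ⁅SemiDirectSum.inr δ d', ⁅SemiDirectSum.inr δ d, m⁆⁆ := by
          rw [leibniz_lie, ← LieHom.map_lie, hD, map_zero, zero_lie, zero_add]
        rw [hD, map_zero, map_zero, map_zero, zero_smul, sub_zero, LinearMap.zero_apply]
        change 0 = (⁅SemiDirectSum.inr δ d, ⁅SemiDirectSum.inr δ d', m⁆ - χ d' • m⁆ -
          χ d • (⁅SemiDirectSum.inr δ d', m⁆ - χ d' • m)) -
          (⁅SemiDirectSum.inr δ d', ⁅SemiDirectSum.inr δ d, m⁆ - χ d • m⁆ -
          χ d' • (⁅SemiDirectSum.inr δ d, m⁆ - χ d • m))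
        rw [lie_sub, lie_sub, lie_smul, lie_smul, smul_sub, smul_sub, h, smul_comm (χ d') (χ d)]
        abel }
    fun d z => LinearMap.ext fun m => by
      have h := hM.inr_lie_adicEnd he hδ d z m
      change hM.adicEnd he (δ d z) m =
        (⁅SemiDirectSum.inr δ d, hM.adicEnd he z m⁆ - χ d • hM.adicEnd he z m) -
          hM.adicEnd he z (⁅SemiDirectSum.inr δ d, m⁆ - χ d • m)
      rw [h, map_sub, map_smul]
      abel

/-- The representation of `B ⋊ D` on `Hom(N, M)` in which `B` acts on `M` only, through an
idempotent of the completion of `A`, and `D` acts by commutators. -/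
def IsSmooth.homRep (hM : IsSmooth δ M Q) (he : IsAdicCauchy Q e)
    (hidem : ∀ n, e n * e n - e n ∈ Q ^ n) (hδ : ∀ d (a : A) z, δ d (a • z) = a • δ d z) :
    (B ⋊⁅δ⁆ D) →ₗ⁅ℂ⁆ Module.End ℂ (N →ₗ[ℂ] M) :=
  SemiDirect.lift
    { (LinearMap.llcomp ℂ N M M).comp (hM.adicEnd he) with
      map_lie' := fun {y z} => LinearMap.ext fun T => LinearMap.ext fun m =>
        LinearMap.congr_fun (LieHom.map_lie (hM.adicRep he hidem) y z) (T m) }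
    ((LieModule.toEnd ℂ (B ⋊⁅δ⁆ D) (N →ₗ[ℂ] M)).comp (SemiDirectSum.inr δ))
    fun d z => LinearMap.ext fun T => LinearMap.ext fun m => by
      have h := hM.inr_lie_adicEnd he hδ d z (T m)
      change hM.adicEnd he (δ d z) (T m) =
        (⁅SemiDirectSum.inr δ d, hM.adicEnd he z (T m)⁆ -
          hM.adicEnd he z (T ⁅SemiDirectSum.inr δ d, m⁆)) -
          hM.adicEnd he z (⁅SemiDirectSum.inr δ d, T m⁆ - T ⁅SemiDirectSum.inr δ d, m⁆)
      rw [h, map_sub]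
      abel

end Splitting

/-! ### The tensor product decomposition -/

section Decomposition

variable {ι : Type*} [Fintype ι] {C : Matrix ι ι ℤ}
  {𝔥 : Type*} [AddCommGroup 𝔥] [Module ℂ 𝔥] {R : Realization C 𝔥}
  {A : Type*} [CommRing A] [Algebra ℂ A] {𝔥₂ : LieSubalgebra ℂ (KMAlgebra R)}
  {ψ₁ ψ₂ : Module.Dual ℂ (LoopCartan R A 𝔥₂)} {I J : Ideal A} {a b : positiveRoots R → ℕ}

/-- An element that is close to `(1, 0)` in `A / I ^ n × A / J ^ n` takes a defining relation of
`M(ψ₁, I)` to a defining relation of `M(ψ₁ + ψ₂, K)`. -/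
lemma LoopRel.eventually_smul {e : ℕ → A} (he : ∀ n, e n ∈ J ^ n ∧ 1 - e n ∈ I ^ n)
    (hψ₁ : VanishesOn R ψ₁ I) (hψ₂ : VanishesOn R ψ₂ J) {z : A ⊗[ℂ] derived R} {c : ℂ}
    (h : LoopRel ψ₁ (fun β => I ^ a β) z c) :
    ∀ᶠ n in atTop, LoopRel (ψ₁ + ψ₂) (fun β => I ^ a β ⊓ J ^ b β) (e n • z) c := by
  cases h with
  | nPlus X hX r => exact Eventually.of_forall fun n => LoopRel.nPlus X hX (e n * r)
  | cartan x r =>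
    -- the powers must be positive, since `ψ₁` and `ψ₂` need not vanish on `𝔥' ⊗ A`
    filter_upwards [eventually_ge_atTop 1] with n hn
    have h₂ : ψ₂ ((e n * r) ⊗ₜ[ℂ] x, 0) = 0 :=
      hψ₂ _ (Ideal.mul_mem_right _ _ (Ideal.pow_le_self (by omega) (he n).1)) x
    have h₁ : ψ₁ (((1 - e n) * r) ⊗ₜ[ℂ] x, 0) = 0 :=
      hψ₁ _ (Ideal.mul_mem_right _ _ (Ideal.pow_le_self (by omega) (he n).2)) x
    have hsum : ((r ⊗ₜ[ℂ] x, 0) : LoopCartan R A 𝔥₂) =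
        ((e n * r) ⊗ₜ[ℂ] x, 0) + (((1 - e n) * r) ⊗ₜ[ℂ] x, 0) := by
      rw [Prod.mk_add_mk, ← TensorProduct.add_tmul, add_zero]
      congr 2
      ring
    have hc : ψ₁ (r ⊗ₜ[ℂ] x, 0) = (ψ₁ + ψ₂) ((e n * r) ⊗ₜ[ℂ] x, 0) := by
      rw [hsum, map_add, h₁, LinearMap.add_apply, h₂]
    rw [hc]
    exact LoopRel.cartan x (e n * r)
  | root β X hX r hr =>
    filter_upwards [eventually_ge_atTop (b β)] with n hn
    exact LoopRel.root β X hX (e n * r) ⟨Ideal.mul_mem_left _ _ hr,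
      Ideal.mul_mem_right _ _ (Ideal.pow_le_pow_right hn (he n).1)⟩

/-- A relation of `M(ψ₁, I)` holds on the highest weight vector of `M(ψ₁ + ψ₂, K)` if `𝔤' ⊗ A` acts
through the idempotent `(1, 0)` of the completion `lim A / I ^ n × lim A / J ^ n`. -/
lemma LoopRel.adicEnd_hwv {e : ℕ → A} (he : ∀ n, e n ∈ J ^ n ∧ 1 - e n ∈ I ^ n)
    (hψ₁ : VanishesOn R ψ₁ I) (hψ₂ : VanishesOn R ψ₂ J)
    {ψ : Module.Dual ℂ (LoopCartan R A 𝔥₂)} (hψ : ψ = ψ₁ + ψ₂) {K : positiveRoots R → Ideal A}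
    (hK : K = fun β => I ^ a β ⊓ J ^ b β) {Q : Ideal A}
    (hM : IsSmooth (loopAction R A 𝔥₂) (HWModule R ψ K) Q) (hQ : IsAdicCauchy Q e)
    {z : A ⊗[ℂ] derived R} {c : ℂ} (h : LoopRel ψ₁ (fun β => I ^ a β) z c) :
    hM.adicEnd hQ z (HWModule.hwv ψ K) = c • HWModule.hwv ψ K := by
  subst hψ hK
  refine hM.adicEnd_eq_of_eventually hQ ?_
  filter_upwards [h.eventually_smul (b := b) he hψ₁ hψ₂] with n hn
  exact HWModule.lie_inl_hwv hn

section LeftInverse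

variable {M : Type*} [AddCommGroup M] [Module ℂ M] [LieRingModule (LoopAlgebra R A 𝔥₂) M]
  [LieModule ℂ (LoopAlgebra R A 𝔥₂) M] {Q : Ideal A} {e f : ℕ → A}
  {K₁ K₂ : positiveRoots R → Ideal A}

/-- The map `T : M(ψ₂, K₂) → M` that takes `u v₂` to `u v`, where `u` acts on `M` through the
idempotent `f` of the completion and `𝔥''` acts with a shift by `ψ₁`. -/
lemma exists_factorMap (h𝔥₂ : IsCartanComplement R 𝔥₂) (hM : IsSmooth (loopAction R A 𝔥₂) M Q)
    (hf : IsAdicCauchy Q f) (hfi : ∀ n, f n * f n - f n ∈ Q ^ n) {v : M}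
    (hv : ∀ z c, LoopRel ψ₂ K₂ z c → hM.adicEnd hf z v = c • v)
    (hinr : ∀ y, ⁅SemiDirectSum.inr (loopAction R A 𝔥₂) y, v⁆ = (ψ₁ (0, y) + ψ₂ (0, y)) • v) :
    ∃ T : HWModule R ψ₂ K₂ →ₗ[ℂ] M, T (HWModule.hwv ψ₂ K₂) = v ∧
      (∀ z m, T ⁅SemiDirectSum.inl (loopAction R A 𝔥₂) z, m⁆ = hM.adicEnd hf z (T m)) ∧
      ∀ y m, T ⁅SemiDirectSum.inr (loopAction R A 𝔥₂) y, m⁆ =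
        ⁅SemiDirectSum.inr (loopAction R A 𝔥₂) y, T m⁆ - ψ₁ (0, y) • T m := by
  obtain ⟨T, hTv, hT⟩ := HWModule.exists_lift (ψ := ψ₂) (K := K₂)
    (hM.shiftedRep hf hfi loopAction_smul h𝔥₂.lie_eq_zero (ψ₁ ∘ₗ LinearMap.inr ℂ _ _)) v
    (fun z c hz => by
      rw [IsSmooth.shiftedRep, SemiDirect.lift_inl]
      exact hv z c hz)
    (fun y => by
      rw [IsSmooth.shiftedRep, SemiDirect.lift_inr]
      change ⁅SemiDirectSum.inr (loopAction R A 𝔥₂) y, v⁆ - ψ₁ (0, y) • v = _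
      rw [hinr, add_smul, add_sub_cancel_left])
  refine ⟨T, hTv, fun z m => ?_, fun y m => ?_⟩
  · rw [hT, IsSmooth.shiftedRep, SemiDirect.lift_inl]; rfl
  · rw [hT, IsSmooth.shiftedRep, SemiDirect.lift_inr]; rfl

/-- The relations of `M(ψ₁, K₁)`, for the action through `e`, hold on the whole image of `T`, since
this action commutes with the action through the orthogonal idempotent `f`. -/
lemma adicEnd_factorMap (h𝔥₂ : IsCartanComplement R 𝔥₂) (hM : IsSmooth (loopAction R A 𝔥₂) M Q)
    (he : IsAdicCauchy Q e) (hf : IsAdicCauchy Q f) (hef : ∀ n, e n * f n ∈ Q ^ n)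
    (T : HWModule R ψ₂ K₂ →ₗ[ℂ] M)
    (hv : ∀ z c, LoopRel ψ₁ K₁ z c →
      hM.adicEnd he z (T (HWModule.hwv ψ₂ K₂)) = c • T (HWModule.hwv ψ₂ K₂))
    (hTinl : ∀ z m, T ⁅SemiDirectSum.inl (loopAction R A 𝔥₂) z, m⁆ = hM.adicEnd hf z (T m))
    (hTinr : ∀ y m, T ⁅SemiDirectSum.inr (loopAction R A 𝔥₂) y, m⁆ =
        ⁅SemiDirectSum.inr (loopAction R A 𝔥₂) y, T m⁆ - ψ₁ (0, y) • T m)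
    (m : HWModule R ψ₂ K₂) :
    ∀ z c, LoopRel ψ₁ K₁ z c → hM.adicEnd he z (T m) = c • T m := by
  let N : Submodule ℂ (HWModule R ψ₂ K₂) :=
    { carrier := {m | ∀ z c, LoopRel ψ₁ K₁ z c → hM.adicEnd he z (T m) = c • T m}
      zero_mem' := fun z c _ => by rw [map_zero, map_zero, smul_zero]
      add_mem' := fun {m m'} hm hm' z c hz => by
        rw [map_add, map_add, hm z c hz, hm' z c hz, smul_add]
      smul_mem' := fun r m hm z c hz => by
        rw [map_smul, map_smul, hm z c hz, smul_comm] }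
  have hN : N = ⊤ := by
    refine HWModule.eq_top_of_stable hv (fun y m hm z c hz => ?_) (fun y m hm z c hz => ?_)
    · rw [hTinl, hM.adicEnd_comm he hf hef, hm z c hz, map_smul]
    · have h := hM.inr_lie_adicEnd he loopAction_smul y z (T m)
      rw [hm _ _ (hz.lie_inr h𝔥₂ y), zero_smul, zero_add, hm z c hz, lie_smul] at h
      rw [hTinr, map_sub, ← h, map_smul, hm z c hz, smul_sub, smul_comm c]
  exact (hN ▸ Submodule.mem_top : m ∈ N)

/-- In the second argument of a bilinear map that is compatible with the actions through `e` in the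
first argument, `𝔤' ⊗ A` acts through `f` as soon as it does so over the highest weight vector. -/
lemma adicEnd_apply_eq {N : Type*} [AddCommGroup N] [Module ℂ N]
    [LieRingModule (LoopAlgebra R A 𝔥₂) N] [LieModule ℂ (LoopAlgebra R A 𝔥₂) N]
    (hM : IsSmooth (loopAction R A 𝔥₂) M Q) (he : IsAdicCauchy Q e) (hf : IsAdicCauchy Q f)
    (hef : ∀ n, e n * f n ∈ Q ^ n) (Θ : HWModule R ψ₁ K₁ →ₗ[ℂ] N →ₗ[ℂ] M)
    (hv : ∀ z n, Θ (HWModule.hwv ψ₁ K₁) ⁅SemiDirectSum.inl (loopAction R A 𝔥₂) z, n⁆ =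
      hM.adicEnd hf z (Θ (HWModule.hwv ψ₁ K₁) n))
    (hΘinl : ∀ z m n, Θ ⁅SemiDirectSum.inl (loopAction R A 𝔥₂) z, m⁆ n =
      hM.adicEnd he z (Θ m n))
    (hΘinr : ∀ y m n, Θ ⁅SemiDirectSum.inr (loopAction R A 𝔥₂) y, m⁆ n =
      ⁅SemiDirectSum.inr (loopAction R A 𝔥₂) y, Θ m n⁆ -
        Θ m ⁅SemiDirectSum.inr (loopAction R A 𝔥₂) y, n⁆) (m : HWModule R ψ₁ K₁) :
    ∀ z n, Θ m ⁅SemiDirectSum.inl (loopAction R A 𝔥₂) z, n⁆ = hM.adicEnd hf z (Θ m n) := by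
  let S : Submodule ℂ (HWModule R ψ₁ K₁) :=
    { carrier := {m | ∀ z n, Θ m ⁅SemiDirectSum.inl (loopAction R A 𝔥₂) z, n⁆ =
        hM.adicEnd hf z (Θ m n)}
      zero_mem' := fun z n => by
        rw [map_zero, LinearMap.zero_apply, LinearMap.zero_apply, map_zero]
      add_mem' := fun {m m'} hm hm' z n => by
        rw [map_add, LinearMap.add_apply, LinearMap.add_apply, hm, hm', map_add]
      smul_mem' := fun r m hm z n => by
        rw [map_smul, LinearMap.smul_apply, LinearMap.smul_apply, hm, map_smul] }
  have hS : S = ⊤ := by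
    refine HWModule.eq_top_of_stable hv (fun y m hm z n => ?_) (fun y m hm z n => ?_)
    · exact (hΘinl y m _).trans <| (congrArg (hM.adicEnd he y) (hm z n)).trans <|
        (hM.adicEnd_comm he hf hef y z _).trans (congrArg (hM.adicEnd hf z) (hΘinl y m n).symm)
    · have h := hM.inr_lie_adicEnd hf loopAction_smul y z (Θ m n)
      have h₁ := hm z n
      have h₂ := hm (loopAction R A 𝔥₂ y z) n
      have h₃ := hm z ⁅SemiDirectSum.inr (loopAction R A 𝔥₂) y, n⁆
      refine (hΘinr y m _).trans (Eq.trans ?_ (congrArg (hM.adicEnd hf z) (hΘinr y m n).symm))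
      rw [h₁, h, inr_lie_inl y z n, map_add (Θ m), h₂, h₃, map_sub]
      abel
  exact (hS ▸ Submodule.mem_top : m ∈ S)

set_option maxHeartbeats 400000 in
/-- Let `e` and `f = 1 - e` represent orthogonal idempotents of the completion of `A`. If `v` is a
highest weight vector in `M` for the actions through `e` and through `f`, with the relations of
`M(ψ₁, K₁)` and of `M(ψ₂, K₂)`, then `v₁ ⊗ v₂ ↦ v` extends to a homomorphism of modules. -/
lemma exists_tensorMap (h𝔥₂ : IsCartanComplement R 𝔥₂) (hM : IsSmooth (loopAction R A 𝔥₂) M Q)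
    (he : IsAdicCauchy Q e) (hf : IsAdicCauchy Q f) (hei : ∀ n, e n * e n - e n ∈ Q ^ n)
    (hfi : ∀ n, f n * f n - f n ∈ Q ^ n) (hef : ∀ n, e n * f n ∈ Q ^ n)
    (hsum : ∀ n, e n + f n = 1) {v : M}
    (hv₁ : ∀ z c, LoopRel ψ₁ K₁ z c → hM.adicEnd he z v = c • v)
    (hv₂ : ∀ z c, LoopRel ψ₂ K₂ z c → hM.adicEnd hf z v = c • v)
    (hinr : ∀ y, ⁅SemiDirectSum.inr (loopAction R A 𝔥₂) y, v⁆ = (ψ₁ (0, y) + ψ₂ (0, y)) • v) :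
    ∃ Φ : HWModule R ψ₁ K₁ ⊗[ℂ] HWModule R ψ₂ K₂ →ₗ[ℂ] M,
      Φ (HWModule.hwv ψ₁ K₁ ⊗ₜ[ℂ] HWModule.hwv ψ₂ K₂) = v ∧
      ∀ (x : LoopAlgebra R A 𝔥₂) w, Φ ⁅x, w⁆ = ⁅x, Φ w⁆ := by
  obtain ⟨T, hTv, hTinl, hTinr⟩ := exists_factorMap h𝔥₂ hM hf hfi hv₂ hinr
  obtain ⟨Θ, hΘv, hΘ⟩ := HWModule.exists_lift (ψ := ψ₁) (K := K₁)
    (hM.homRep he hei loopAction_smul) T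
    (fun z c hz => by
      rw [IsSmooth.homRep, SemiDirect.lift_inl]
      refine LinearMap.ext fun m => ?_
      exact adicEnd_factorMap h𝔥₂ hM he hf hef T (by rw [hTv]; exact hv₁) hTinl hTinr m z c hz)
    (fun y => by
      rw [IsSmooth.homRep, SemiDirect.lift_inr]
      refine LinearMap.ext fun m => ?_
      change ⁅SemiDirectSum.inr (loopAction R A 𝔥₂) y, T m⁆ -
        T ⁅SemiDirectSum.inr (loopAction R A 𝔥₂) y, m⁆ = ψ₁ (0, y) • T m
      rw [hTinr, sub_sub_cancel])
  have hΘinl : ∀ z m n, Θ ⁅SemiDirectSum.inl (loopAction R A 𝔥₂) z, m⁆ n =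
      hM.adicEnd he z (Θ m n) :=
    fun z m n => by rw [hΘ, IsSmooth.homRep, SemiDirect.lift_inl]; rfl
  have hΘinr : ∀ y m n, Θ ⁅SemiDirectSum.inr (loopAction R A 𝔥₂) y, m⁆ n =
      ⁅SemiDirectSum.inr (loopAction R A 𝔥₂) y, Θ m n⁆ -
        Θ m ⁅SemiDirectSum.inr (loopAction R A 𝔥₂) y, n⁆ :=
    fun y m n => by rw [hΘ, IsSmooth.homRep, SemiDirect.lift_inr]; rfl
  have hΘinl' : ∀ m z n, Θ m ⁅SemiDirectSum.inl (loopAction R A 𝔥₂) z, n⁆ =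
      hM.adicEnd hf z (Θ m n) :=
    adicEnd_apply_eq hM he hf hef Θ
      (fun z n => (LinearMap.congr_fun hΘv _).trans ((hTinl z n).trans
        (congrArg (hM.adicEnd hf z) (LinearMap.congr_fun hΘv n).symm))) hΘinl hΘinr
  have hinl : ∀ z m n, TensorProduct.lift Θ ⁅SemiDirectSum.inl (loopAction R A 𝔥₂) z, m ⊗ₜ[ℂ] n⁆ =
      ⁅SemiDirectSum.inl (loopAction R A 𝔥₂) z, Θ m n⁆ := fun z m n => by
    rw [TensorProduct.LieModule.lie_tmul_right, map_add, TensorProduct.lift.tmul,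
      TensorProduct.lift.tmul, hΘinl z m n, hΘinl' m z n, hM.adicEnd_add he hf hsum z]
  have hinr : ∀ y m n, TensorProduct.lift Θ ⁅SemiDirectSum.inr (loopAction R A 𝔥₂) y, m ⊗ₜ[ℂ] n⁆ =
      ⁅SemiDirectSum.inr (loopAction R A 𝔥₂) y, Θ m n⁆ := fun y m n => by
    rw [TensorProduct.LieModule.lie_tmul_right, map_add, TensorProduct.lift.tmul,
      TensorProduct.lift.tmul, hΘinr y m n, sub_add_cancel]
  refine ⟨TensorProduct.lift Θ, ?_, fun x w => ?_⟩
  · rw [TensorProduct.lift.tmul, hΘv, hTv]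
  · induction w using TensorProduct.induction_on with
    | zero => rw [lie_zero, map_zero, lie_zero]
    | add w w' hw hw' => rw [lie_add, map_add, map_add, hw, hw', lie_add]
    | tmul m n =>
      obtain ⟨z, y, rfl⟩ : ∃ z y, x = SemiDirectSum.inl (loopAction R A 𝔥₂) z +
          SemiDirectSum.inr (loopAction R A 𝔥₂) y := ⟨_, _, (SemiDirect.inl_add_inr x).symm⟩
      rw [add_lie _ _ (m ⊗ₜ[ℂ] n), map_add, hinl z m n, hinr y m n, TensorProduct.lift.tmul,
        add_lie _ _ (Θ m n)]

end LeftInverse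

/-- For coprime `I` and `J`, a homomorphism `M(ψ₁ + ψ₂, K) → M(ψ₁, I) ⊗ M(ψ₂, J)` that takes `v` to
`v₁ ⊗ v₂` has a left inverse. -/
lemma injective_of_hwv_tmul (hC : IsGeneralizedCartan C) (h𝔥₂ : IsCartanComplement R 𝔥₂)
    (hIJ : IsCoprime I J) (hψ₁ : VanishesOn R ψ₁ I) (hψ₂ : VanishesOn R ψ₂ J)
    (φ : HWModule R (ψ₁ + ψ₂) (fun β => I ^ a β ⊓ J ^ b β) →ₗ[ℂ]
      HWModule R ψ₁ (fun β => I ^ a β) ⊗[ℂ] HWModule R ψ₂ (fun β => J ^ b β))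
    (hφv : φ (HWModule.hwv _ _) = HWModule.hwv _ _ ⊗ₜ[ℂ] HWModule.hwv _ _)
    (hφ : ∀ (x : LoopAlgebra R A 𝔥₂) m, φ ⁅x, m⁆ = ⁅x, φ m⁆) : Function.Injective φ := by
  obtain ⟨e, he⟩ := exists_seq_of_isCoprime hIJ
  have hf : ∀ n, 1 - e n ∈ I ^ n ∧ 1 - (1 - e n) ∈ J ^ n := fun n =>
    ⟨(he n).2, by rw [sub_sub_cancel]; exact (he n).1⟩
  have heC := isAdicCauchy_of_isCoprime hIJ he
  have hfC : IsAdicCauchy (I ⊓ J) fun n => 1 - e n := by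
    rw [inf_comm]
    exact isAdicCauchy_of_isCoprime hIJ.symm hf
  have hfi : ∀ n, (1 - e n) * (1 - e n) - (1 - e n) ∈ (I ⊓ J) ^ n := by
    rw [inf_comm]
    exact mul_self_sub_mem_of_isCoprime hIJ.symm hf
  have hM : IsSmooth (loopAction R A 𝔥₂)
      (HWModule R (ψ₁ + ψ₂) (fun β => I ^ a β ⊓ J ^ b β)) (I ⊓ J) :=
    HWModule.isSmooth hC fun β => ⟨a β ⊔ b β, le_inf
      ((Ideal.pow_le_pow_right le_sup_left).trans (Ideal.pow_right_mono inf_le_left _))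
      ((Ideal.pow_le_pow_right le_sup_right).trans (Ideal.pow_right_mono inf_le_right _))⟩
  obtain ⟨Φ, hΦv, hΦ⟩ := exists_tensorMap (K₁ := fun β => I ^ a β) (K₂ := fun β => J ^ b β)
    h𝔥₂ hM heC hfC (mul_self_sub_mem_of_isCoprime hIJ he) hfi
    (mul_one_sub_mem_of_isCoprime hIJ he) (fun n => add_sub_cancel _ _)
    (fun z c hz => hz.adicEnd_hwv he hψ₁ hψ₂ rfl rfl hM heC)
    (fun z c hz => hz.adicEnd_hwv (b := a) hf hψ₂ hψ₁ (add_comm _ _)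
      (funext fun β => inf_comm _ _) hM hfC)
    (fun y => HWModule.lie_inr_hwv y)
  have hΦφ : LinearMap.eqLocus (Φ ∘ₗ φ) LinearMap.id = ⊤ := by
    refine CyclicModule.eq_top_of_lie_stable ?_ fun x m hm => ?_
    · exact (congrArg Φ hφv).trans hΦv
    · change Φ (φ m) = m at hm
      change Φ (φ ⁅x, m⁆) = ⁅x, m⁆
      rw [hφ, hΦ, hm]
  exact Function.LeftInverse.injective (g := Φ) fun m =>
    (hΦφ ▸ Submodule.mem_top : m ∈ LinearMap.eqLocus (Φ ∘ₗ φ) LinearMap.id)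

/-- For coprime `I` and `J`, the vector `v₁ ⊗ v₂` generates `M(ψ₁, I) ⊗ M(ψ₂, J)`: on given `m` and
`n`, a suitable `e : A` makes `e • z` act on `m ⊗ n` as `z` on `m` alone, or on `n` alone. -/
lemma eq_top_of_hwv_tmul_mem (hC : IsGeneralizedCartan C) (hIJ : IsCoprime I J)
    (W : Submodule ℂ
      (HWModule R ψ₁ (fun β => I ^ a β) ⊗[ℂ] HWModule R ψ₂ (fun β => J ^ b β)))
    (hv : HWModule.hwv _ _ ⊗ₜ[ℂ] HWModule.hwv _ _ ∈ W)
    (hW : ∀ (x : LoopAlgebra R A 𝔥₂), ∀ w ∈ W, ⁅x, w⁆ ∈ W) : W = ⊤ := by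
  obtain ⟨e, he⟩ := exists_seq_of_isCoprime hIJ
  have hM₁ : IsSmooth (loopAction R A 𝔥₂) (HWModule R ψ₁ (fun β => I ^ a β)) I :=
    HWModule.isSmooth hC fun β => ⟨a β, le_rfl⟩
  have hM₂ : IsSmooth (loopAction R A 𝔥₂) (HWModule R ψ₂ (fun β => J ^ b β)) J :=
    HWModule.isSmooth hC fun β => ⟨b β, le_rfl⟩
  have hleft : ∀ z m n, m ⊗ₜ[ℂ] n ∈ W →
      ⁅SemiDirectSum.inl (loopAction R A 𝔥₂) z, m⁆ ⊗ₜ[ℂ] n ∈ W := by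
    intro z m n hmn
    obtain ⟨k, h₁, h₂⟩ := ((hM₁.eventually_eq_zero (fun n => (he n).2) z m).and
      (hM₂.eventually_eq_zero (fun n => (he n).1) z n)).exists
    have h := hW (SemiDirectSum.inl (loopAction R A 𝔥₂) (e k • z)) _ hmn
    rw [sub_smul, one_smul, map_sub, sub_lie, sub_eq_zero] at h₁
    rwa [TensorProduct.LieModule.lie_tmul_right, h₂, TensorProduct.tmul_zero, add_zero,
      ← h₁] at h
  have hright : ∀ z m n, m ⊗ₜ[ℂ] n ∈ W →
      m ⊗ₜ[ℂ] ⁅SemiDirectSum.inl (loopAction R A 𝔥₂) z, n⁆ ∈ W := by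
    intro z m n hmn
    have h := W.sub_mem (hW (SemiDirectSum.inl (loopAction R A 𝔥₂) z) _ hmn) (hleft z m n hmn)
    rwa [TensorProduct.LieModule.lie_tmul_right, add_sub_cancel_left] at h
  have h₁ : W.comap ((TensorProduct.mk ℂ _ _).flip (HWModule.hwv _ _)) = ⊤ := by
    refine HWModule.eq_top_of_stable hv (fun z m hm => hleft z m _ hm) fun y m hm => ?_
    have h := W.sub_mem (hW (SemiDirectSum.inr (loopAction R A 𝔥₂) y) _ hm)
      (W.smul_mem (ψ₂ (0, y)) hm)
    change ⁅_, m ⊗ₜ[ℂ] HWModule.hwv ψ₂ (fun β => J ^ b β)⁆ -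
      ψ₂ (0, y) • (m ⊗ₜ[ℂ] HWModule.hwv ψ₂ (fun β => J ^ b β)) ∈ W at h
    rwa [TensorProduct.LieModule.lie_tmul_right, HWModule.lie_inr_hwv, TensorProduct.tmul_smul,
      add_sub_cancel_right] at h
  have h₂ : ⨅ m, W.comap (TensorProduct.mk ℂ (HWModule R ψ₁ (fun β => I ^ a β))
      (HWModule R ψ₂ (fun β => J ^ b β)) m) = ⊤ := by
    refine HWModule.eq_top_of_stable ?_ (fun z n hn => ?_) fun y n hn => ?_
    · rw [Submodule.mem_iInf]
      exact fun m => (h₁ ▸ Submodule.mem_top :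
        m ∈ W.comap ((TensorProduct.mk ℂ _ _).flip (HWModule.hwv _ _)))
    · rw [Submodule.mem_iInf] at hn ⊢
      exact fun m => hright z m n (hn m)
    · rw [Submodule.mem_iInf] at hn ⊢
      intro m
      have h := W.sub_mem (hW (SemiDirectSum.inr (loopAction R A 𝔥₂) y) _ (hn m))
        (hn ⁅SemiDirectSum.inr (loopAction R A 𝔥₂) y, m⁆)
      rw [TensorProduct.mk_apply, TensorProduct.mk_apply, TensorProduct.LieModule.lie_tmul_right,
        add_sub_cancel_left] at h
      exact h
  refine eq_top_iff.2 ?_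
  rw [← TensorProduct.span_tmul_eq_top, Submodule.span_le]
  rintro _ ⟨m, n, rfl⟩
  exact (Submodule.mem_iInf _).1 (h₂ ▸ Submodule.mem_top : n ∈ ⨅ m, W.comap
    (TensorProduct.mk ℂ (HWModule R ψ₁ (fun β => I ^ a β)) _ m)) m

/-- The tensor product decomposition for coprime ideals, with arbitrary exponents. -/
theorem nonempty_hwModule_equiv_tensor (hC : IsGeneralizedCartan C)
    (h𝔥₂ : IsCartanComplement R 𝔥₂) (hIJ : IsCoprime I J) (hψ₁ : VanishesOn R ψ₁ I)
    (hψ₂ : VanishesOn R ψ₂ J) (a b : positiveRoots R → ℕ) :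
    Nonempty (HWModule R (ψ₁ + ψ₂) (fun β => I ^ a β ⊓ J ^ b β) ≃ₗ⁅ℂ, LoopAlgebra R A 𝔥₂⁆
      (HWModule R ψ₁ (fun β => I ^ a β) ⊗[ℂ] HWModule R ψ₂ (fun β => J ^ b β))) := by
  obtain ⟨φ, hφv, hφ⟩ := HWModule.exists_lift (ψ := ψ₁ + ψ₂)
    (K := fun β => I ^ a β ⊓ J ^ b β)
    (LieModule.toEnd ℂ (LoopAlgebra R A 𝔥₂)
      (HWModule R ψ₁ (fun β => I ^ a β) ⊗[ℂ] HWModule R ψ₂ (fun β => J ^ b β)))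
    (HWModule.hwv _ _ ⊗ₜ[ℂ] HWModule.hwv _ _)
    (fun z c hz => by
      obtain ⟨c₁, c₂, h₁, h₂, rfl⟩ : ∃ c₁ c₂, LoopRel ψ₁ (fun β => I ^ a β) z c₁ ∧
          LoopRel ψ₂ (fun β => J ^ b β) z c₂ ∧ c = c₁ + c₂ := by
        cases hz with
        | nPlus X hX r => exact ⟨0, 0, .nPlus X hX r, .nPlus X hX r, (add_zero 0).symm⟩
        | cartan x r => exact ⟨_, _, .cartan x r, .cartan x r, rfl⟩
        | root β X hX r hr =>
          exact ⟨0, 0, .root β X hX r hr.1, .root β X hX r hr.2, (add_zero 0).symm⟩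
      rw [LieModule.toEnd_apply_apply, TensorProduct.LieModule.lie_tmul_right,
        HWModule.lie_inl_hwv h₁, HWModule.lie_inl_hwv h₂, TensorProduct.tmul_smul,
        ← TensorProduct.smul_tmul', ← add_smul])
    (fun y => by
      rw [LieModule.toEnd_apply_apply, TensorProduct.LieModule.lie_tmul_right,
        HWModule.lie_inr_hwv, HWModule.lie_inr_hwv, TensorProduct.tmul_smul, LinearMap.add_apply,
        ← TensorProduct.smul_tmul', ← add_smul])
  have hinj := injective_of_hwv_tmul hC h𝔥₂ hIJ hψ₁ hψ₂ φ hφv hφ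
  have hsurj : LinearMap.range φ = ⊤ := by
    refine eq_top_of_hwv_tmul_mem hC hIJ _ ⟨_, hφv⟩ ?_
    rintro x _ ⟨m, rfl⟩
    exact ⟨⁅x, m⁆, hφ x m⟩
  exact ⟨{ LinearEquiv.ofBijective φ ⟨hinj, LinearMap.range_eq_top.1 hsurj⟩ with
    map_lie' := fun {x m} => hφ x m }⟩

end Decomposition

end KacMoody
end

open KacMoody in
theorem mainTheorem3 {ι : Type*} [Fintype ι] (C : Matrix ι ι ℤ) (hC : IsGeneralizedCartan C)
    {𝔥 : Type*} [AddCommGroup 𝔥] [Module ℂ 𝔥] [FiniteDimensional ℂ 𝔥] (R : Realization C 𝔥)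
    (𝔥₂ : LieSubalgebra ℂ (KMAlgebra R)) (h𝔥₂ : IsCartanComplement R 𝔥₂)
    {A : Type*} [CommRing A] [Algebra ℂ A] [Algebra.FiniteType ℂ A]
    (I J : Ideal A) (hI : FiniteDimensional ℂ (A ⧸ I)) (hJ : FiniteDimensional ℂ (A ⧸ J))
    (hIJ : IsCoprime I J)
    (ψ₁ ψ₂ : Module.Dual ℂ (LoopCartan R A 𝔥₂)) (l m : Module.Dual ℂ 𝔥)
    (hl : IsDominantIntegral R l) (hm : IsDominantIntegral R m)
    (hψ₁I : VanishesOn R ψ₁ I) (hψ₂J : VanishesOn R ψ₂ J)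
    (hψ₁l : RestrictsTo R ψ₁ l) (hψ₂m : RestrictsTo R ψ₂ m) :
    Nonempty
      (HWModule R (ψ₁ + ψ₂) (fun α => I ^ rootLevel R l α ⊓ J ^ rootLevel R m α)
        ≃ₗ⁅ℂ, LoopAlgebra R A 𝔥₂⁆
          (HWModuleOfIdeal R ψ₁ l I ⊗[ℂ] HWModuleOfIdeal R ψ₂ m J)) :=
  nonempty_hwModule_equiv_tensor hC h𝔥₂ hIJ hψ₁I hψ₂J _ _
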